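/- For $t>0$ let $e^{t\Delta}f=G(\cdot,t)*f$ with the heat kernel $G(x,t)=(4\pi t)^{-3/2}e^{-|x|^2/(4t)}$ on $\mathbb{R}^3$, and let $e^{0\Delta}f=f$. Let $$L^2_{st}=\{\nabla_{sym}u:\ u\in\dot H^1(\mathbb{R}^3;\mathbb{R}^3),\ \nabla\cdot u=0\}\subset L^2(\mathbb{R}^3;\mathbb{R}^{3\times3}),\qquad (\nabla_{sym}u)_{ij}=\tfrac12(\partial_iu_j+\partial_ju_i),$$ where matrices carry the Frobenius norm, and let $P_{st}$ be the orthogonal projection of $L^2(\mathbb{R}^3;\mathbb{R}^{3\times3})$ onto $L^2_{st}$. For $0\le T\le\infty$, a mild solution on $[0,T)$ of the strain self-amplification model equation $\partial_tS-\Delta S+\frac23P_{st}(S^2)=0$ with initial data $S^0\in L^2_{st}$ is a function $S\in C([0,T);L^2_{st})$ with $S(0)=S^0$ such that for all $0<t<T$ $$S(t)=e^{t\Delta}S^0-\frac23\int_0^te^{\tau\Delta}P_{st}\big(S^2(t-\tau)\big)\,d\tau .$$ Here $S^2(x)$ is the matrix square, which is in $L^1$, $e^{\tau\Delta}P_{st}$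 is understood on $L^1$ as $P_{st}e^{\tau\Delta}$, and the integral is a (convergent) Bochner integral in $L^2$. **Theorem.** Let $C=\left(\frac{3}{32\|g\|_{L^2}}\right)^4$, where $g(x)=G(x,1)=\frac{1}{(4\pi)^{3/2}}\exp\left(-\frac{|x|^2}{4}\right)$. For every $S^0\in L^2_{st}$ there are a time $T_{max}\in(0,\infty]$ with $$T_{max}\ge\frac{C}{\|S^0\|_{L^2}^4}$$ (in particular $T_{max}=\infty$ if $S^0=0$) and a mild solution $S\in C([0,T_{max});L^2_{st})$ with initial data $S^0$. The solution is unique and $T_{max}$ is the maximal time of existence: if $R$ is any mild solution with initial data $S^0$ on an interval $[0,T)$, $0\le T\le\infty$, then $T\le T_{max}$ and $R=S$ on $[0,T)$. Furthermore $S\in C((0,T_{max});H^\infty)$, that is, for every $s\ge0$ the map $t\mapsto S(t)$ is continuous from $(0,T_{max})$ to $H^s$ with norm $\|f\|_{H^s}^2=\int(1+(2\pi|\xi|)^{2s})|\hat f(\xi)|^2\,d\xi$, where $\hat f(\xi)=\int f(x)e^{-2\pi i x\cdot\xi}\,dx$; therefore, for every $0<t<T_{max}$, $S(t)$ agrees almost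 everywhere with a $C^\infty$ function on $\mathbb{R}^3$. -/

import Mathlib

open MeasureTheory Filter Topology
open scoped ENNReal FourierTransform ContDiff

/-- Physical space `ℝ³` with the Euclidean norm. -/
abbrev E3 : Type := EuclideanSpace ℝ (Fin 3)

/-- Real `3 × 3` matrices with the Frobenius (Hilbert–Schmidt) norm and inner product. -/
abbrev Mat3 : Type := EuclideanSpace ℝ (Fin 3 × Fin 3)

/-- Complex `3 × 3` matrices with the Frobenius norm. -/
abbrev CMat3 : Type := EuclideanSpace ℂ (Fin 3 × Fin 3)

/-- The Hilbert space `L²(ℝ³; ℝ^{3×3})`. -/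
abbrev L2Mat : Type := Lp Mat3 2 (volume : Measure E3)

/-! ### Fourier transform of matrix valued `L²` functions -/

/-- The inclusion of real matrices in complex matrices. -/
noncomputable def complexify : Mat3 →L[ℝ] CMat3 :=
  LinearMap.toContinuousLinearMap
    { toFun := fun A => WithLp.toLp 2 fun p => (A p : ℂ)
      map_add' := fun A B => by ext p; simp
      map_smul' := fun c A => by ext p; simp }

/-- The `L²` Fourier transform (kernel `exp (-2πi x·ξ)`), entry by entry. -/
noncomputable def fourierMat (S : L2Mat) : Lp CMat3 2 (volume : Measure E3) :=
  𝓕 (complexify.compLp S)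

theorem fourierMat_add (S T : L2Mat) : fourierMat (S + T) = fourierMat S + fourierMat T := by
  unfold fourierMat
  rw [show complexify.compLp (S + T) = complexify.compLp S + complexify.compLp T from
    (complexify.compLpL 2 (volume : Measure E3)).map_add S T]
  exact FourierTransform.fourier_add _ _

theorem fourierMat_smul (c : ℝ) (S : L2Mat) : fourierMat (c • S) = (c : ℂ) • fourierMat S := by
  unfold fourierMat
  rw [show complexify.compLp (c • S) = c • complexify.compLp S from
    (complexify.compLpL 2 (volume : Measure E3)).map_smul c S,
    show c • complexify.compLp S = (c : ℂ) • complexify.compLp S by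
      ext1
      filter_upwards [Lp.coeFn_smul c (complexify.compLp S),
        Lp.coeFn_smul (c : ℂ) (complexify.compLp S)] with x h1 h2
      rw [h1, h2]
      simp]
  exact FourierTransform.fourier_smul _ _

/-! ### The constraint space `L²_st` -/

/-- A real divergence free vector field `u ∈ Ḣ¹(ℝ³; ℝ³)`, given by its Fourier transform `û`:
`‖u‖²_{Ḣ¹} = ∫ (2π|ξ|)² |û(ξ)|² dξ` is finite (so `û` is locally integrable), `u` is real valued,
i.e. `û(-ξ)` is the conjugate of `û(ξ)`, and `ξ · û(ξ) = 0` almost everywhere. -/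
structure HDotOneDivFree where
  /-- The Fourier transform of the vector field. -/
  hat : E3 → EuclideanSpace ℂ (Fin 3)
  aestronglyMeasurable : AEStronglyMeasurable hat volume
  norm_lt_top : ∫⁻ ξ, ENNReal.ofReal ((2 * Real.pi * ‖ξ‖) ^ 2) * ‖hat ξ‖ₑ ^ 2 < ⊤
  real : ∀ᵐ ξ, ∀ i, hat (-ξ) i = starRingEnd ℂ (hat ξ i)
  div_free : ∀ᵐ ξ, ∑ i, (ξ i : ℂ) * hat ξ i = 0

/-- The Fourier transform of `∇_sym u`, where `(∇_sym u)_{ij} = (∂_i u_j + ∂_j u_i) / 2` and the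
Fourier transform of `∂_i u_j` is `2πi ξ_i û_j`. -/
noncomputable def HDotOneDivFree.symGradHat (u : HDotOneDivFree) (ξ : E3) : CMat3 :=
  WithLp.toLp 2 fun p =>
    (1 / 2 : ℂ) * (2 * Real.pi * Complex.I * ξ p.1 * u.hat ξ p.2
      + 2 * Real.pi * Complex.I * ξ p.2 * u.hat ξ p.1)

/-- `S = ∇_sym u`. -/
def IsSymGrad (S : L2Mat) (u : HDotOneDivFree) : Prop :=
  ∀ᵐ ξ, fourierMat S ξ = u.symGradHat ξ

/-- The constraint space `L²_st = {∇_sym u : u ∈ Ḣ¹, ∇ · u = 0}` of strain matrices. -/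
noncomputable def L2st : Submodule ℝ L2Mat where
  carrier := {S | ∃ u, IsSymGrad S u}
  zero_mem' := by
    refine ⟨⟨0, aestronglyMeasurable_zero, by simp, by simp, by simp⟩, ?_⟩
    have h : fourierMat 0 = 0 := by simpa using fourierMat_smul 0 0
    unfold IsSymGrad
    rw [h]
    filter_upwards [Lp.coeFn_zero CMat3 2 (volume : Measure E3)] with ξ hξ
    rw [hξ]
    ext p
    simp [HDotOneDivFree.symGradHat]
  add_mem' := by
    rintro S T ⟨u, hu⟩ ⟨v, hv⟩
    refine ⟨⟨u.hat + v.hat, u.aestronglyMeasurable.add v.aestronglyMeasurable, ?_, ?_, ?_⟩, ?_⟩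
    · refine lt_of_le_of_lt (lintegral_mono (g := fun ξ =>
        2 * (ENNReal.ofReal ((2 * Real.pi * ‖ξ‖) ^ 2) * ‖u.hat ξ‖ₑ ^ 2)
        + 2 * (ENNReal.ofReal ((2 * Real.pi * ‖ξ‖) ^ 2) * ‖v.hat ξ‖ₑ ^ 2)) fun ξ => ?_) ?_
      · have h : ‖(u.hat + v.hat) ξ‖ₑ ^ 2 ≤ 2 * ‖u.hat ξ‖ₑ ^ 2 + 2 * ‖v.hat ξ‖ₑ ^ 2 := by
          refine (pow_le_pow_left' (enorm_add_le _ _) 2).trans ?_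
          have h2 := ENNReal.rpow_add_le_mul_rpow_add_rpow ‖u.hat ξ‖ₑ ‖v.hat ξ‖ₑ
            (one_le_two : (1 : ℝ) ≤ 2)
          norm_num [mul_add] at h2
          exact h2
        refine (mul_le_mul_right h _).trans (le_of_eq ?_)
        ring
      · have m : ∀ w : HDotOneDivFree, AEMeasurable (fun ξ : E3 =>
            2 * (ENNReal.ofReal ((2 * Real.pi * ‖ξ‖) ^ 2) * ‖w.hat ξ‖ₑ ^ 2)) volume := fun w => by
          have := w.aestronglyMeasurable.enorm
          fun_prop
        rw [lintegral_add_left' (m u), lintegral_const_mul' _ _ (by simp),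
          lintegral_const_mul' _ _ (by simp)]
        exact ENNReal.add_lt_top.2 ⟨ENNReal.mul_lt_top (by simp) u.norm_lt_top,
          ENNReal.mul_lt_top (by simp) v.norm_lt_top⟩
    · filter_upwards [u.real, v.real] with ξ h1 h2 i
      simp [h1, h2]
    · filter_upwards [u.div_free, v.div_free] with ξ h1 h2
      simp [mul_add, Finset.sum_add_distrib, h1, h2]
    · unfold IsSymGrad
      rw [fourierMat_add]
      filter_upwards [Lp.coeFn_add (fourierMat S) (fourierMat T), hu, hv] with ξ h h1 h2
      rw [h, Pi.add_apply, h1, h2]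
      ext p
      simp [HDotOneDivFree.symGradHat]
      ring
  smul_mem' := by
    rintro c S ⟨u, hu⟩
    refine ⟨⟨(c : ℂ) • u.hat, u.aestronglyMeasurable.const_smul _, ?_, ?_, ?_⟩, ?_⟩
    · simp only [Pi.smul_apply, enorm_smul, mul_pow, mul_left_comm _ (‖(c : ℂ)‖ₑ ^ 2)]
      rw [lintegral_const_mul' _ _ (by simp)]
      refine ENNReal.mul_lt_top (by simp) (lt_of_eq_of_lt ?_ u.norm_lt_top)
      simp only [mul_pow]
    · filter_upwards [u.real] with ξ h1 i
      simp [h1]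
    · filter_upwards [u.div_free] with ξ h1
      simp only [Pi.smul_apply, PiLp.smul_apply, smul_eq_mul, mul_left_comm _ (c : ℂ)]
      rw [← Finset.mul_sum, h1, mul_zero]
    · unfold IsSymGrad
      rw [fourierMat_smul]
      filter_upwards [Lp.coeFn_smul (c : ℂ) (fourierMat S), hu] with ξ h h1
      rw [h, Pi.smul_apply, h1]
      ext p
      simp [HDotOneDivFree.symGradHat]
      ring

/-- The orthogonal projection `P_st` of `L²(ℝ³; ℝ^{3×3})` onto `L²_st`. (`L²_st` is closed, so that
passing to its closure changes nothing; it makes the projection available at once.) -/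
noncomputable def Pst : L2Mat →L[ℝ] L2Mat :=
  L2st.topologicalClosure.starProjection

/-! ### The heat semigroup -/

/-- The heat kernel `G(x,t) = (4πt)^{-3/2} exp(-|x|²/(4t))`. -/
noncomputable def heatKernel (t : ℝ) (x : E3) : ℝ :=
  1 / (4 * Real.pi * t) ^ (3 / 2 : ℝ) * Real.exp (-‖x‖ ^ 2 / (4 * t))

/-- The convolution `G(·,t) * f`. -/
noncomputable def heatConv (t : ℝ) (f : E3 → Mat3) (x : E3) : Mat3 :=
  ∫ y, heatKernel t y • f (x - y)

theorem lintegral_conv_sq_le {a b : E3 → ℝ≥0∞} (ha : AEMeasurable a) (hb : AEMeasurable b) :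
    ∫⁻ x, (∫⁻ y, a y * b (x - y)) ^ 2 ≤ (∫⁻ y, a y) ^ 2 * ∫⁻ y, b y ^ 2 := by
  have hb' : ∀ x, AEMeasurable fun y => b (x - y) := fun x =>
    hb.comp_quasiMeasurePreserving (quasiMeasurePreserving_sub_left_of_right_invariant volume x)
  have key : ∀ x, (∫⁻ y, a y * b (x - y)) ^ 2 ≤ (∫⁻ y, a y) * ∫⁻ y, a y * b (x - y) ^ 2 := by
    intro x
    have h := ENNReal.lintegral_mul_le_Lp_mul_Lq (volume : Measure E3) Real.HolderConjugate.two_two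
      (f := fun y => a y ^ (1 / 2 : ℝ)) (g := fun y => a y ^ (1 / 2 : ℝ) * b (x - y))
      (ha.pow_const _) ((ha.pow_const _).mul (hb' x))
    have e1 : ∀ c : ℝ≥0∞, (c ^ (1 / 2 : ℝ)) ^ (2 : ℝ) = c := fun c => by
      rw [← ENNReal.rpow_mul]; norm_num
    have e2 : ∀ c : ℝ≥0∞, c ^ (1 / 2 : ℝ) * c ^ (1 / 2 : ℝ) = c := fun c => by
      rw [← ENNReal.rpow_add_of_nonneg _ _ (by norm_num) (by norm_num)]; norm_num
    simp only [Pi.mul_apply, ← mul_assoc, e2, e1,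
      ENNReal.mul_rpow_of_nonneg _ _ (zero_le_two : (0 : ℝ) ≤ 2)] at h
    refine (pow_le_pow_left' h 2).trans (le_of_eq ?_)
    rw [mul_pow, ← ENNReal.rpow_natCast, ← ENNReal.rpow_natCast]
    push_cast
    rw [e1, e1]
    simp only [ENNReal.rpow_two]
  have hab : AEMeasurable (fun p : E3 × E3 => a p.2 * b (p.1 - p.2) ^ 2)
      ((volume : Measure E3).prod volume) :=
    ha.comp_snd.mul ((hb.comp_quasiMeasurePreserving
      (quasiMeasurePreserving_sub_of_right_invariant volume volume)).pow_const 2)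
  calc ∫⁻ x, (∫⁻ y, a y * b (x - y)) ^ 2
      ≤ ∫⁻ x, (∫⁻ y, a y) * ∫⁻ y, a y * b (x - y) ^ 2 := lintegral_mono key
    _ = (∫⁻ y, a y) * ∫⁻ x, ∫⁻ y, a y * b (x - y) ^ 2 :=
        lintegral_const_mul'' _ hab.lintegral_prod_right'
    _ = (∫⁻ y, a y) * ∫⁻ y, ∫⁻ x, a y * b (x - y) ^ 2 := by rw [lintegral_lintegral_swap hab]
    _ = (∫⁻ y, a y) * ∫⁻ y, a y * ∫⁻ x, b x ^ 2 := by
        congr 1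
        refine lintegral_congr fun y => ?_
        have hy : AEMeasurable fun x => b (x - y) ^ 2 := (hb.comp_quasiMeasurePreserving
          (measurePreserving_sub_right volume y).quasiMeasurePreserving).pow_const 2
        rw [lintegral_const_mul'' _ hy, lintegral_sub_right_eq_self (fun x => b x ^ 2) y]
    _ = (∫⁻ y, a y) ^ 2 * ∫⁻ y, b y ^ 2 := by
        rw [lintegral_mul_const'' _ ha, sq, mul_assoc]

theorem memLp_heatKernel {t : ℝ} (ht : 0 < t) :
    MemLp (heatKernel t) 1 ∧ MemLp (heatKernel t) 2 := by
  have hg : ∀ b : ℝ, 0 < b → Integrable fun x : E3 => Real.exp (-b * ‖x‖ ^ 2) := by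
    intro b hb
    have h := (GaussianFourier.integrable_cexp_neg_mul_sq_norm_add (V := E3)
      (b := (b : ℂ)) (by simpa using hb) 0 0).norm
    refine h.congr (Eventually.of_forall fun x => ?_)
    simp [Complex.norm_exp, ← Complex.ofReal_pow]
  have hc : Continuous (heatKernel t) := by
    unfold heatKernel
    fun_prop
  constructor
  · rw [memLp_one_iff_integrable]
    refine ((hg (1 / (4 * t)) (by positivity)).const_mul
      (1 / (4 * Real.pi * t) ^ (3 / 2 : ℝ))).congr (Eventually.of_forall fun x => ?_)
    simp only [heatKernel]
    congr 2
    ring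
  · rw [memLp_two_iff_integrable_sq hc.aestronglyMeasurable]
    refine ((hg (1 / (2 * t)) (by positivity)).const_mul
      ((1 / (4 * Real.pi * t) ^ (3 / 2 : ℝ)) ^ 2)).congr (Eventually.of_forall fun x => ?_)
    simp only [heatKernel, mul_pow, ← Real.exp_nat_mul]
    congr 2
    push_cast
    field_simp
    ring

theorem memLp_heatConv_aux {t : ℝ} {f : E3 → Mat3} (hk : AEStronglyMeasurable (heatKernel t))
    (hf : AEStronglyMeasurable f)
    (h : ∫⁻ x, (∫⁻ y, ‖heatKernel t y‖ₑ * ‖f (x - y)‖ₑ) ^ 2 < ⊤) : MemLp (heatConv t f) 2 := by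
  refine ⟨(hk.convolution_integrand (ContinuousLinearMap.lsmul ℝ ℝ) hf).integral_prod_right', ?_⟩
  rw [eLpNorm_lt_top_iff_lintegral_rpow_enorm_lt_top two_ne_zero ENNReal.ofNat_ne_top]
  refine lt_of_le_of_lt (lintegral_mono fun x => ?_) h
  simp only [ENNReal.toReal_ofNat, ENNReal.rpow_ofNat]
  refine pow_le_pow_left' ((enorm_integral_le_lintegral_enorm _).trans (le_of_eq ?_)) 2
  simp only [enorm_smul]

theorem memLp_heatConv_of_memLp_two {t : ℝ} (ht : 0 < t) {f : E3 → Mat3} (hf : MemLp f 2) :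
    MemLp (heatConv t f) 2 := by
  have hk := (memLp_heatKernel ht).1
  refine memLp_heatConv_aux hk.1 hf.1
    ((lintegral_conv_sq_le hk.1.enorm hf.1.enorm).trans_lt (ENNReal.mul_lt_top ?_ ?_))
  · exact ENNReal.pow_lt_top (by simpa [eLpNorm_one_eq_lintegral_enorm] using hk.2)
  · simpa using (eLpNorm_lt_top_iff_lintegral_rpow_enorm_lt_top two_ne_zero
      ENNReal.ofNat_ne_top).1 hf.2

theorem memLp_heatConv_of_memLp_one {t : ℝ} (ht : 0 < t) {f : E3 → Mat3} (hf : MemLp f 1) :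
    MemLp (heatConv t f) 2 := by
  have hk := (memLp_heatKernel ht).2
  refine memLp_heatConv_aux hk.1 hf.1 (lt_of_eq_of_lt (lintegral_congr fun x => ?_)
    ((lintegral_conv_sq_le hf.1.enorm hk.1.enorm).trans_lt (ENNReal.mul_lt_top ?_ ?_)))
  · rw [← lintegral_sub_left_eq_self _ x]
    simp only [sub_sub_cancel, mul_comm]
  · exact ENNReal.pow_lt_top (by simpa [eLpNorm_one_eq_lintegral_enorm] using hf.2)
  · simpa using (eLpNorm_lt_top_iff_lintegral_rpow_enorm_lt_top two_ne_zero
      ENNReal.ofNat_ne_top).1 hk.2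

/-- `e^{tΔ} f = G(·,t) * f` for `f ∈ L²` and `t > 0`, and `e^{0Δ} f = f`. -/
noncomputable def heatL2 (t : ℝ) (f : L2Mat) : L2Mat :=
  if ht : 0 < t then (memLp_heatConv_of_memLp_two ht (Lp.memLp f)).toLp _ else f

/-- `e^{tΔ} F = G(·,t) * F`, an element of `L²`, for `F ∈ L¹` and `t > 0`
(the value for `t ≤ 0` is not used). -/
noncomputable def heatL1 (t : ℝ) (F : Lp Mat3 1 (volume : Measure E3)) : L2Mat :=
  if ht : 0 < t then (memLp_heatConv_of_memLp_one ht (Lp.memLp F)).toLp _ else 0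

/-! ### Mild solutions -/

/-- The square of a `3 × 3` matrix. -/
noncomputable def matSq (A : Mat3) : Mat3 :=
  WithLp.toLp 2 fun p => ∑ k, A (p.1, k) * A (k, p.2)

theorem memLp_matSq (S : L2Mat) : MemLp (fun x => matSq (S x)) 1 (volume : Measure E3) := by
  refine MemLp.of_eval_piLp fun p => ?_
  have h : ∀ q, MemLp (fun x => S x q) 2 (volume : Measure E3) := (Lp.memLp S).eval_piLp
  have hi : ∀ k, Integrable (fun x => S x (p.1, k) * S x (k, p.2)) (volume : Measure E3) :=
    fun k => (h (p.1, k)).integrable_mul (h (k, p.2))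
  rw [memLp_one_iff_integrable]
  exact integrable_finsetSum Finset.univ fun k _ => hi k

/-- The matrix square `S² ∈ L¹` of `S ∈ L²`. -/
noncomputable def sqL1 (S : L2Mat) : Lp Mat3 1 (volume : Measure E3) :=
  (memLp_matSq S).toLp _

/-- The integrand `e^{τΔ} P_st (S²(t - τ))` of Duhamel's formula. Since `S²(t - τ)` is only in `L¹`,
the heat semigroup, which commutes with `P_st` and maps `L¹` to `L²`, is applied first. -/
noncomputable def duhamelIntegrand (S : ℝ → L2Mat) (t τ : ℝ) : L2Mat :=
  Pst (heatL1 τ (sqL1 (S (t - τ))))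

/-- `S ∈ C([0,T); L²_st)`, `0 ≤ T ≤ ∞`, is a mild solution with initial data `S⁰` of the strain
self-amplification model equation `∂_t S - ΔS + (2/3) P_st(S²) = 0`. -/
structure IsMildSolution (S0 : L2Mat) (T : ℝ≥0∞) (S : ℝ → L2Mat) : Prop where
  mem : ∀ t, 0 ≤ t → ENNReal.ofReal t < T → S t ∈ L2st
  continuousOn : ContinuousOn S {t | 0 ≤ t ∧ ENNReal.ofReal t < T}
  initial : S 0 = S0
  integrable : ∀ t, 0 < t → ENNReal.ofReal t < T →
    IntervalIntegrable (duhamelIntegrand S t) volume 0 t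
  duhamel : ∀ t, 0 < t → ENNReal.ofReal t < T →
    S t = heatL2 t S0 - (2 / 3 : ℝ) • ∫ τ in (0 : ℝ)..t, duhamelIntegrand S t τ

/-! ### Sobolev norms -/

/-- `‖f‖²_{H^s} = ∫ (1 + (2π|ξ|)^{2s}) |f̂(ξ)|² dξ` for `f ∈ L²` and `s ≥ 0`; `f` is in `H^s` if and
only if this is finite. -/
noncomputable def sobolevNormSq (s : ℝ) (f : L2Mat) : ℝ≥0∞ :=
  ∫⁻ ξ, ENNReal.ofReal (1 + (2 * Real.pi * ‖ξ‖) ^ (2 * s)) * ‖fourierMat f ξ‖ₑ ^ 2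

/-- `S ∈ C((0,T); H^∞)`, where `H^∞` is the intersection of the `H^s`, `s ≥ 0`, with the topology
given by all their norms. -/
def ContinuousHInfty (T : ℝ≥0∞) (S : ℝ → L2Mat) : Prop :=
  ∀ s : ℝ, 0 ≤ s → ∀ t : ℝ, 0 < t → ENNReal.ofReal t < T →
    sobolevNormSq s (S t) < ⊤ ∧ Tendsto (fun τ => sobolevNormSq s (S τ - S t)) (𝓝 t) (𝓝 0)

/-- The Gaussian `g(x) = (4π)^{-3/2} exp(-|x|²/4)`, the heat kernel at time `1`. -/
noncomputable def gaussianProfile (x : E3) : ℝ :=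
  1 / (4 * Real.pi) ^ (3 / 2 : ℝ) * Real.exp (-‖x‖ ^ 2 / 4)

/-- The constant `C = (3 / (32 ‖g‖_{L²}))⁴`, a positive real number. -/
noncomputable def existenceConst : ℝ≥0∞ :=
  (3 / (32 * eLpNorm gaussianProfile 2 volume)) ^ 4

/-! Existence rests on one smoothing estimate. Young's inequality gives `‖e^{τΔ}F‖₂ ≤ ‖G(·,τ)‖₂
‖F‖₁`, and by scaling `‖G(·,τ)‖₂ = ‖g‖₂ τ^{-3/4}`. Since `‖S²‖₁ ≤ ‖S‖₂²` for the Frobenius norm and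
`P_st` is a contraction, the Duhamel integrand is at most `‖g‖₂ τ^{-3/4} ‖S‖₂²`. This singularity is
integrable, with `∫₀ᵗ τ^{-3/4} dτ = 4 t^{1/4}`. Picard iteration in `C([0,T]; L²)` on the ball of
radius `2‖S⁰‖` therefore contracts as soon as `(32/3) ‖g‖₂ T^{1/4} ‖S⁰‖ < 1`, which is `T < C/‖S⁰‖⁴`
(`exists_duhamelMap_fixed`).

Uniqueness is a Gronwall argument for the kernel `τ^{-3/4}`. Against the weight `e^{rt}` with `r`
large, the Duhamel term gains a factor `1/2` (`exists_rate`), and iterating this gain leaves nothing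
but the inhomogeneous term (`le_of_forall_improve`). The maximal time is the supremum of all
existence times, and uniqueness glues the solutions together; no continuation argument is needed.

Smoothness is a weighted energy argument on the Fourier side. The weight `w_t(ξ) = (1 + t min(2π|ξ|,
N))ⁿ` equals `1` at `t = 0`, so it asks nothing of the data. It is submultiplicative in time, so
`w_t` splits into a part at time `τ`, absorbed by half of the heat factor, and a part at time `t -
τ` on the solution. It is subadditive in frequency up to `2ⁿ`, so it can be put on one factor of
`S²`, the other being bounded in `L²`. The weighted norm thus obeys a linear inequality with kernel
`τ^{-3/4}`, and the same Gronwall lemma bounds it uniformly in `N`. The truncation only guarantees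
that the norm is finite beforehand. Letting `N → ∞` gives local bounds on all Sobolev norms for `t >
0`. Interpolation with continuity in `L²` gives continuity in every `H^s`, and integrability of
`|ξ|ⁿ|Ŝ(ξ)|` gives a smooth representative.

For all this the heat flow and the weights must be Fourier multipliers on real matrix fields that
commute with `P_st`. They commute because membership in `L²_st` is a linear condition on `Ŝ(ξ)` for
almost every single `ξ` (`mem_L2st_iff`), which scalar multipliers preserve. -/

/-! ### The Fourier transform on `L²` -/

/-- The Hilbert space `L²(ℝ³; ℂ^{3×3})`. -/
abbrev L2CMat : Type := Lp CMat3 2 (volume : Measure E3)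

theorem locallyIntegrable_of_memLp_two {F : Type*} [NormedAddCommGroup F] {f : E3 → F}
    (hf : MemLp f 2) : LocallyIntegrable f volume :=
  hf.locallyIntegrable (by norm_num)

/-- Both sides have the same integral against every test function: the `L²` transform agrees with
the distributional one, and the integral formula moves `𝓕` onto the test function by Fubini. This
links the Plancherel extension to explicit integrals. -/
theorem fourier_toLp_ae_eq {f : E3 → CMat3} (h1 : Integrable f) (h2 : MemLp f 2) :
    (𝓕 (h2.toLp f) : L2CMat) =ᵐ[volume] 𝓕 f := by
  have hcont : Continuous (𝓕 f) := VectorFourier.fourierIntegral_continuous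
    Real.continuous_fourierChar (by exact continuous_inner) h1
  refine ae_eq_of_integral_contDiff_smul_eq
    (locallyIntegrable_of_memLp_two (Lp.memLp _)) hcont.locallyIntegrable fun g hg hgs => ?_
  have hgs' : HasCompactSupport fun x => (g x : ℂ) := hgs.comp_left (g := fun r : ℝ => (r : ℂ)) rfl
  have hg' : ContDiff ℝ ∞ fun x => (g x : ℂ) := Complex.ofRealCLM.contDiff.comp hg
  let φ : SchwartzMap E3 ℂ := hgs'.toSchwartzMap hg'
  have hφ : ∀ x, φ x = (g x : ℂ) := fun x => rfl
  have e1 := DFunLike.congr_fun (Lp.fourier_toTemperedDistribution_eq (h2.toLp f)) φ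
  rw [TemperedDistribution.fourier_apply, Lp.toTemperedDistribution_apply,
    Lp.toTemperedDistribution_apply] at e1
  have e2 := VectorFourier.integral_fourierIntegral_smul_eq_flip (L := innerₗ E3)
    (f := φ) (g := f) (μ := volume) (ν := volume)
    Real.continuous_fourierChar (by exact continuous_inner) φ.integrable h1
  have e3 : ∫ x, (𝓕 φ) x • (h2.toLp f) x = ∫ x, (𝓕 φ) x • f x := by
    refine integral_congr_ae ?_
    filter_upwards [h2.coeFn_toLp] with x hx
    rw [hx]
  rw [flip_innerₗ] at e2
  have e4 : ∫ x, (𝓕 φ) x • f x = ∫ x, φ x • (𝓕 f) x := e2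
  rw [e3, e4] at e1
  simpa [hφ] using e1.symm

theorem fourierInv_toLp_ae_eq {f : E3 → CMat3} (h1 : Integrable f) (h2 : MemLp f 2) :
    (𝓕⁻ (h2.toLp f) : L2CMat) =ᵐ[volume] 𝓕⁻ f := by
  have hcont : Continuous (𝓕⁻ f) := VectorFourier.fourierIntegral_continuous
    Real.continuous_fourierChar (by exact continuous_inner.neg) h1
  refine ae_eq_of_integral_contDiff_smul_eq
    (locallyIntegrable_of_memLp_two (Lp.memLp _)) hcont.locallyIntegrable fun g hg hgs => ?_
  have hgs' : HasCompactSupport fun x => (g x : ℂ) := hgs.comp_left (g := fun r : ℝ => (r : ℂ)) rfl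
  have hg' : ContDiff ℝ ∞ fun x => (g x : ℂ) := Complex.ofRealCLM.contDiff.comp hg
  let φ : SchwartzMap E3 ℂ := hgs'.toSchwartzMap hg'
  have hφ : ∀ x, φ x = (g x : ℂ) := fun x => rfl
  have e1 := DFunLike.congr_fun (Lp.fourierInv_toTemperedDistribution_eq (h2.toLp f)) φ
  rw [TemperedDistribution.fourierInv_apply, Lp.toTemperedDistribution_apply,
    Lp.toTemperedDistribution_apply] at e1
  have e2 := VectorFourier.integral_fourierIntegral_smul_eq_flip (L := -innerₗ E3)
    (f := φ) (g := f) (μ := volume) (ν := volume)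
    Real.continuous_fourierChar (by exact continuous_inner.neg)
    φ.integrable h1
  have e3 : ∫ x, (𝓕⁻ φ) x • (h2.toLp f) x = ∫ x, (𝓕⁻ φ) x • f x := by
    refine integral_congr_ae ?_
    filter_upwards [h2.coeFn_toLp] with x hx
    rw [hx]
  have e5 : (-innerₗ E3).flip = -innerₗ E3 := by
    ext x y; simp [real_inner_comm]
  rw [e5] at e2
  have e4 : ∫ x, (𝓕⁻ φ) x • f x = ∫ x, φ x • (𝓕⁻ f) x := by
    rw [SchwartzMap.fourierInv_coe]
    exact e2
  rw [e3, e4] at e1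
  simpa [hφ] using e1.symm

/-- A closed property of `L²` functions holds if it holds for functions in `L¹ ∩ L²`. -/
theorem Lp_two_induction {F : Type*} [NormedAddCommGroup F] [NormedSpace ℝ F]
    {P : Lp F 2 (volume : Measure E3) → Prop} (hP : IsClosed {f | P f})
    (h : ∀ (f : E3 → F) (_ : Integrable f) (h2 : MemLp f 2), P (h2.toLp f))
    (f : Lp F 2 (volume : Measure E3)) : P f :=
  DenseRange.induction_on (p := P)
    (SchwartzMap.denseRange_toLpCLM (E := E3) (F := F) (p := 2) ENNReal.ofNat_ne_top) f hP
    fun φ : SchwartzMap E3 F => h φ φ.integrable (φ.memLp 2 volume)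

theorem continuous_fourier_L2 : Continuous fun f : L2CMat => (𝓕 f : L2CMat) :=
  (Lp.fourierTransformₗᵢ E3 CMat3).continuous

theorem continuous_fourierInv_L2 : Continuous fun f : L2CMat => (𝓕⁻ f : L2CMat) :=
  (Lp.fourierTransformₗᵢ E3 CMat3).symm.continuous

/-- A constant matrix operation passes through the Fourier integral on `L¹ ∩ L²`, and density does
the rest. -/
theorem fourier_compLp (L : CMat3 →L[ℂ] CMat3) (f : L2CMat) :
    (𝓕 (L.compLp f) : L2CMat) = L.compLp (𝓕 f : L2CMat) := by
  have hc : Continuous fun f : L2CMat => L.compLp f := (L.compLpL 2 (volume : Measure E3)).continuous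
  refine Lp_two_induction (P := fun f : L2CMat => (𝓕 (L.compLp f) : L2CMat) = L.compLp (𝓕 f : L2CMat))
    (isClosed_eq (continuous_fourier_L2.comp hc) (hc.comp continuous_fourier_L2))
    (fun f h1 h2 => ?_) f
  have h2' : MemLp (fun x => L (f x)) 2 := L.comp_memLp' h2
  have e : L.compLp (h2.toLp f) = h2'.toLp _ := by
    ext1
    filter_upwards [L.coeFn_compLp (h2.toLp f), h2.coeFn_toLp, h2'.coeFn_toLp] with x a b c
    rw [a, b, c]
  rw [e]
  ext1
  filter_upwards [fourier_toLp_ae_eq (L.integrable_comp h1) h2', fourier_toLp_ae_eq h1 h2,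
    L.coeFn_compLp (𝓕 (h2.toLp f) : L2CMat)] with x a b c
  rw [a, c, b, Real.fourier_eq', Real.fourier_eq', ← L.integral_comp_comm]
  · simp
  · simpa [Real.fourierChar_apply, Circle.smul_def, mul_comm, mul_left_comm] using
      (Real.fourierIntegral_convergent_iff (μ := volume) x).2 h1

/-- Reflection `f ↦ f(-·)` on `L²`. -/
noncomputable def reflectL2 : L2CMat →ₗᵢ[ℂ] L2CMat :=
  Lp.compMeasurePreservingₗᵢ ℂ (fun x : E3 => -x) (Measure.measurePreserving_neg volume)

theorem coeFn_reflectL2 (f : L2CMat) : reflectL2 f =ᵐ[volume] fun x => f (-x) :=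
  Lp.coeFn_compMeasurePreserving f (Measure.measurePreserving_neg volume)

theorem fourierInv_eq_reflectL2 (f : L2CMat) : (𝓕⁻ f : L2CMat) = reflectL2 (𝓕 f) := by
  refine Lp_two_induction (P := fun f : L2CMat => (𝓕⁻ f : L2CMat) = reflectL2 (𝓕 f))
    (isClosed_eq continuous_fourierInv_L2 (reflectL2.continuous.comp continuous_fourier_L2))
    (fun f h1 h2 => ?_) f
  ext1
  filter_upwards [fourierInv_toLp_ae_eq h1 h2, coeFn_reflectL2 (𝓕 (h2.toLp f)),
    (Measure.measurePreserving_neg volume).quasiMeasurePreserving.ae_eq_comp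
      (fourier_toLp_ae_eq h1 h2)] with x a b c
  rw [a, b, Real.fourierInv_eq_fourier_neg]
  exact c.symm

/-- Reflection is `𝓕⁻` applied twice, by `fourierInv_eq_reflectL2` at `𝓕⁻ f`, so no integral has to
be computed. -/
theorem fourier_reflectL2 (f : L2CMat) : (𝓕 (reflectL2 f) : L2CMat) = reflectL2 (𝓕 f) := by
  have h := fourierInv_eq_reflectL2 (𝓕⁻ f : L2CMat)
  have h' : (𝓕⁻ f : L2CMat) = reflectL2 (𝓕 f) := fourierInv_eq_reflectL2 f
  rw [FourierTransform.fourier_fourierInv_eq] at h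
  have h3 : reflectL2 f = (𝓕⁻ (𝓕⁻ f : L2CMat) : L2CMat) := h.symm
  rw [h3, FourierTransform.fourier_fourierInv_eq, h']

/-! ### Conjugation, modulation and bounded multipliers -/

/-- Entrywise complex conjugation. -/
noncomputable def conjMat : CMat3 →L[ℝ] CMat3 :=
  LinearMap.toContinuousLinearMap
    { toFun := fun A => WithLp.toLp 2 fun p => starRingEnd ℂ (A p)
      map_add' := fun A B => by ext p; simp
      map_smul' := fun c A => by ext p; simp }

/-- Entrywise real part. -/
noncomputable def reMat : CMat3 →L[ℝ] Mat3 :=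
  LinearMap.toContinuousLinearMap
    { toFun := fun A => WithLp.toLp 2 fun p => (A p).re
      map_add' := fun A B => by ext p; simp
      map_smul' := fun c A => by ext p; simp }

@[simp] theorem complexify_apply (A : Mat3) (p : Fin 3 × Fin 3) : complexify A p = (A p : ℂ) := rfl

@[simp] theorem conjMat_apply (A : CMat3) (p : Fin 3 × Fin 3) :
    conjMat A p = starRingEnd ℂ (A p) := rfl

@[simp] theorem reMat_apply (A : CMat3) (p : Fin 3 × Fin 3) : reMat A p = (A p).re := rfl

theorem norm_complexify (A : Mat3) : ‖complexify A‖ = ‖A‖ := by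
  simp [EuclideanSpace.norm_eq]

theorem conjMat_complexify (A : Mat3) : conjMat (complexify A) = complexify A := by
  ext p; simp

theorem complexify_reMat {A : CMat3} (h : conjMat A = A) : complexify (reMat A) = A := by
  ext p
  have := congrArg (fun B : CMat3 => B p) h
  exact Complex.conj_eq_iff_re.1 this

theorem conjMat_smul (c : ℂ) (A : CMat3) : conjMat (c • A) = starRingEnd ℂ c • conjMat A := by
  ext p; simp

theorem conjMat_conjMat (A : CMat3) : conjMat (conjMat A) = A := by
  ext p; simp

/-- Complex conjugation on `L²`. -/
noncomputable def conjL2 : L2CMat →L[ℝ] L2CMat := conjMat.compLpL 2 (volume : Measure E3)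

theorem coeFn_conjL2 (f : L2CMat) : conjL2 f =ᵐ[volume] fun x => conjMat (f x) :=
  conjMat.coeFn_compLpL f

theorem conjL2_conjL2 (f : L2CMat) : conjL2 (conjL2 f) = f := by
  ext1
  filter_upwards [coeFn_conjL2 (conjL2 f), coeFn_conjL2 f] with x a b
  rw [a, b, conjMat_conjMat]

/-- Conjugation flips the sign in the exponential. Together with `fourierInv_eq_reflectL2` this
identifies the transforms of real fields by Hermitian symmetry. -/
theorem fourier_conjL2 (f : L2CMat) : (𝓕 (conjL2 f) : L2CMat) = conjL2 (𝓕⁻ f) := by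
  refine Lp_two_induction (P := fun f : L2CMat => (𝓕 (conjL2 f) : L2CMat) = conjL2 (𝓕⁻ f))
    (isClosed_eq (continuous_fourier_L2.comp conjL2.continuous)
      (conjL2.continuous.comp continuous_fourierInv_L2)) (fun f h1 h2 => ?_) f
  have h2' : MemLp (fun x => conjMat (f x)) 2 := conjMat.comp_memLp' h2
  have e : conjL2 (h2.toLp f) = h2'.toLp _ := by
    ext1
    filter_upwards [coeFn_conjL2 (h2.toLp f), h2.coeFn_toLp, h2'.coeFn_toLp] with x a b c
    rw [a, b, c]
  rw [e]
  ext1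
  filter_upwards [fourier_toLp_ae_eq (conjMat.integrable_comp h1) h2', fourierInv_toLp_ae_eq h1 h2,
    coeFn_conjL2 (𝓕⁻ (h2.toLp f) : L2CMat)] with x a b c
  rw [a, c, b, Real.fourier_eq', Real.fourierInv_eq', ← conjMat.integral_comp_comm]
  · refine integral_congr_ae (Eventually.of_forall fun y => ?_)
    simp only [conjMat_smul]
    congr 1
    rw [← Complex.exp_conj]
    simp [Complex.conj_ofNat]
  · have := (Real.fourierIntegral_convergent_iff (μ := volume) (-x)).2 h1
    simpa [Real.fourierChar_apply, Circle.smul_def] using this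

/-- Multiplication by an essentially bounded function on `L²`. -/
noncomputable def boundedMul (m : E3 → ℂ) (hm : MemLp m ∞) : L2CMat →L[ℂ] L2CMat :=
  (ContinuousLinearMap.lsmul ℂ ℂ).holderL volume ∞ 2 2 (hm.toLp m)

theorem coeFn_boundedMul {m : E3 → ℂ} (hm : MemLp m ∞) (f : L2CMat) :
    boundedMul m hm f =ᵐ[volume] fun x => m x • f x := by
  filter_upwards [(ContinuousLinearMap.lsmul ℂ ℂ).coeFn_holder (r := 2) (hm.toLp m) f,
    hm.coeFn_toLp] with x a b
  rw [← b]
  exact a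

/-- The character `x ↦ exp (-2πi x·ξ)`. -/
noncomputable def character (ξ x : E3) : ℂ := Real.fourierChar (-inner ℝ x ξ)

theorem memLp_character (ξ : E3) : MemLp (character ξ) ∞ := by
  refine memLp_top_of_bound (Continuous.aestronglyMeasurable ?_) 1
    (Eventually.of_forall fun x => (Circle.norm_coe _).le)
  unfold character
  exact continuous_subtype_val.comp (Real.continuous_fourierChar.comp (by fun_prop))

/-- Translation `f ↦ f(· + ξ)` on `L²`. -/
noncomputable def translateL2 (ξ : E3) : L2CMat →ₗᵢ[ℂ] L2CMat :=
  Lp.compMeasurePreservingₗᵢ ℂ (fun x : E3 => x + ξ) (measurePreserving_add_right volume ξ)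

theorem coeFn_translateL2 (ξ : E3) (f : L2CMat) :
    translateL2 ξ f =ᵐ[volume] fun x => f (x + ξ) :=
  Lp.coeFn_compMeasurePreserving f (measurePreserving_add_right volume ξ)

/-- This is the source of the shifted factor `Ŝ(η + ξ)` in `enorm_fourier_sqL1_le`. -/
theorem fourier_modulation (ξ : E3) (f : L2CMat) :
    (𝓕 (boundedMul _ (memLp_character ξ) f) : L2CMat) = translateL2 ξ (𝓕 f) := by
  refine Lp_two_induction (P := fun f : L2CMat =>
      (𝓕 (boundedMul _ (memLp_character ξ) f) : L2CMat) = translateL2 ξ (𝓕 f))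
    (isClosed_eq (continuous_fourier_L2.comp (boundedMul _ _).continuous)
      ((translateL2 ξ).continuous.comp continuous_fourier_L2)) (fun f h1 h2 => ?_) f
  have h1' : Integrable (fun x => character ξ x • f x) :=
    (Real.fourierIntegral_convergent_iff (μ := volume) ξ).2 h1
  have h2' : MemLp (fun x => character ξ x • f x) 2 := by
    refine (Lp.memLp (boundedMul _ (memLp_character ξ) (h2.toLp f))).ae_eq ?_
    filter_upwards [coeFn_boundedMul (memLp_character ξ) (h2.toLp f), h2.coeFn_toLp] with x a b
    rw [a, b]
  have e : boundedMul _ (memLp_character ξ) (h2.toLp f) = h2'.toLp _ := by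
    ext1
    filter_upwards [coeFn_boundedMul (memLp_character ξ) (h2.toLp f), h2.coeFn_toLp,
      h2'.coeFn_toLp] with x a b c
    rw [a, b, c]
  rw [e]
  ext1
  filter_upwards [fourier_toLp_ae_eq h1' h2', coeFn_translateL2 ξ (𝓕 (h2.toLp f)),
    (measurePreserving_add_right volume ξ).quasiMeasurePreserving.ae_eq_comp
      (fourier_toLp_ae_eq h1 h2)] with x a b c
  rw [a, b]
  refine Eq.trans ?_ c.symm
  simp only [Function.comp_apply, Real.fourier_eq]
  refine integral_congr_ae (Eventually.of_forall fun y => ?_)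
  simp only [character, Circle.smul_def, smul_smul]
  congr 1
  rw [← Circle.coe_mul, ← AddChar.map_add_eq_mul, inner_add_right, neg_add]

/-! ### The Fourier transform of real matrix fields -/

theorem norm_fourierMat (S : L2Mat) : ‖fourierMat S‖ = ‖S‖ := by
  unfold fourierMat
  rw [Lp.norm_fourier_eq]
  refine le_antisymm (Lp.norm_le_norm_of_ae_le ?_) (Lp.norm_le_norm_of_ae_le ?_) <;>
  · filter_upwards [complexify.coeFn_compLp S] with x hx
    rw [hx, norm_complexify]

/-- The Fourier transform as a real linear isometry. -/
noncomputable def fourierMatLI : L2Mat →ₗᵢ[ℝ] L2CMat where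
  toFun := fourierMat
  map_add' := fourierMat_add
  map_smul' c S := by
    rw [fourierMat_smul]
    ext1
    filter_upwards [Lp.coeFn_smul c (fourierMat S),
      Lp.coeFn_smul (c : ℂ) (fourierMat S)] with x h1 h2
    rw [RingHom.id_apply, h1, h2]
    simp
  norm_map' := norm_fourierMat

theorem fourierMat_sub (S T : L2Mat) : fourierMat (S - T) = fourierMat S - fourierMat T :=
  map_sub fourierMatLI S T

theorem fourierMat_injective : Function.Injective fourierMat := fourierMatLI.injective

theorem continuous_fourierMat : Continuous fourierMat := fourierMatLI.continuous

theorem inner_fourierMat (S T : L2Mat) :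
    inner ℝ S T = (inner ℂ (fourierMat S) (fourierMat T)).re := by
  unfold fourierMat
  rw [Lp.inner_fourier_eq, L2.inner_def, L2.inner_def]
  refine Eq.trans (integral_congr_ae ?_) (integral_re (𝕜 := ℂ) (L2.integrable_inner (𝕜 := ℂ) _ _))
  filter_upwards [complexify.coeFn_compLp S, complexify.coeFn_compLp T] with x hx hy
  rw [hx, hy]
  simp [PiLp.inner_apply]

theorem reflectL2_fourierMat (S : L2Mat) : reflectL2 (fourierMat S) = conjL2 (fourierMat S) := by
  have h : conjL2 (complexify.compLp S) = complexify.compLp S := by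
    ext1
    filter_upwards [coeFn_conjL2 (complexify.compLp S), complexify.coeFn_compLp S] with x a b
    rw [a, b, conjMat_complexify]
  have h2 := fourier_conjL2 (complexify.compLp S)
  rw [h, fourierInv_eq_reflectL2] at h2
  unfold fourierMat
  conv_rhs => rw [h2, conjL2_conjL2]

/-- The real part of the inverse Fourier transform. -/
noncomputable def reFourierInv : L2CMat →L[ℝ] L2Mat :=
  (reMat.compLpL 2 (volume : Measure E3)).comp
    (((Lp.fourierTransformₗᵢ E3 CMat3).symm : L2CMat →L[ℂ] L2CMat).restrictScalars ℝ)

/-- Hermitian symmetry makes the inverse transform invariant under conjugation, hence real, so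
taking the real part loses nothing. -/
theorem fourierMat_reFourierInv {h : L2CMat} (hh : reflectL2 h = conjL2 h) :
    fourierMat (reFourierInv h) = h := by
  have h1 := fourier_conjL2 h
  rw [← hh, fourier_reflectL2, ← fourierInv_eq_reflectL2] at h1
  have h2 : complexify.compLp (reFourierInv h) = (𝓕⁻ h : L2CMat) := by
    ext1
    have c : (reFourierInv h : L2Mat) =ᵐ[volume] fun x => reMat ((𝓕⁻ h : L2CMat) x) :=
      reMat.coeFn_compLpL (𝓕⁻ h : L2CMat)
    filter_upwards [complexify.coeFn_compLp (reFourierInv h), coeFn_conjL2 (𝓕⁻ h : L2CMat), c]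
      with x a b c
    rw [← h1] at b
    rw [a, c, complexify_reMat b.symm]
  unfold fourierMat
  rw [h2, FourierTransform.fourier_fourierInv_eq]

theorem reFourierInv_fourierMat (S : L2Mat) : reFourierInv (fourierMat S) = S :=
  fourierMat_injective (fourierMat_reFourierInv (reflectL2_fourierMat S))

theorem memLp_ofReal_comp {m : E3 → ℝ} (hm : MemLp m ∞) : MemLp (fun ξ => (m ξ : ℂ)) ∞ :=
  hm.ofReal

/-- The Fourier multiplier with a bounded real symbol, on real matrix fields. -/
noncomputable def fourierMul (m : E3 → ℝ) (hm : MemLp m ∞) : L2Mat →L[ℝ] L2Mat :=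
  reFourierInv.comp (((boundedMul _ (memLp_ofReal_comp hm)).restrictScalars ℝ).comp
    fourierMatLI.toContinuousLinearMap)

/-- A real even symbol preserves Hermitian symmetry. Evenness is needed because `reFourierInv`
discards any imaginary part of the product's inverse transform. -/
theorem fourierMat_fourierMul {m : E3 → ℝ} (hm : MemLp m ∞) (he : ∀ ξ, m (-ξ) = m ξ) (S : L2Mat) :
    fourierMat (fourierMul m hm S) =ᵐ[volume] fun ξ => (m ξ : ℂ) • fourierMat S ξ := by
  have h : fourierMat (fourierMul m hm S) = boundedMul _ (memLp_ofReal_comp hm) (fourierMat S) := by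
    refine fourierMat_reFourierInv ?_
    change reflectL2 (boundedMul _ (memLp_ofReal_comp hm) (fourierMat S)) =
      conjL2 (boundedMul _ (memLp_ofReal_comp hm) (fourierMat S))
    have hr := reflectL2_fourierMat S
    ext1
    filter_upwards [coeFn_reflectL2 (boundedMul _ (memLp_ofReal_comp hm) (fourierMat S)),
      coeFn_conjL2 (boundedMul _ (memLp_ofReal_comp hm) (fourierMat S)),
      coeFn_boundedMul (memLp_ofReal_comp hm) (fourierMat S),
      (Measure.measurePreserving_neg volume).quasiMeasurePreserving.ae_eq_comp
        (coeFn_boundedMul (memLp_ofReal_comp hm) (fourierMat S)),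
      coeFn_reflectL2 (fourierMat S), coeFn_conjL2 (fourierMat S)] with x a b c d e f
    simp only [Function.comp_apply] at d
    rw [a, b, c, d, ← e, hr, f, conjMat_smul, he, Complex.conj_ofReal]
  rw [h]
  exact coeFn_boundedMul _ _

theorem inner_fourierMul {m : E3 → ℝ} (hm : MemLp m ∞) (he : ∀ ξ, m (-ξ) = m ξ) (S T : L2Mat) :
    inner ℝ (fourierMul m hm S) T = inner ℝ S (fourierMul m hm T) := by
  rw [inner_fourierMat, inner_fourierMat, L2.inner_def, L2.inner_def]
  congr 1
  refine integral_congr_ae ?_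
  filter_upwards [fourierMat_fourierMul hm he S, fourierMat_fourierMul hm he T] with ξ a b
  rw [a, b, inner_smul_left, inner_smul_right, Complex.conj_ofReal]

/-! ### The constraint space -/

/-- The vector `û(ξ)` recovered from `M = (∇_sym u)^(ξ)` by `û = Mξ / (πi|ξ|²)`. -/
noncomputable def potentialHat (ξ : E3) (M : CMat3) : EuclideanSpace ℂ (Fin 3) :=
  WithLp.toLp 2 fun i => (Real.pi * Complex.I * (‖ξ‖ ^ 2 : ℝ))⁻¹ * ∑ j, (ξ j : ℂ) * M (i, j)

/-- The constraint on `M = Ŝ(ξ)` that characterises strain matrices. -/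
def IsStrainHat (ξ : E3) (M : CMat3) : Prop :=
  ∑ i, (ξ i : ℂ) * potentialHat ξ M i = 0 ∧
    ∀ p : Fin 3 × Fin 3, M p = (1 / 2 : ℂ) *
      (2 * Real.pi * Complex.I * ξ p.1 * potentialHat ξ M p.2
        + 2 * Real.pi * Complex.I * ξ p.2 * potentialHat ξ M p.1)

theorem continuous_potentialHat_apply (ξ : E3) (i : Fin 3) :
    Continuous fun M => potentialHat ξ M i := by
  simp only [potentialHat]
  fun_prop

theorem isClosed_isStrainHat (ξ : E3) : IsClosed {M | IsStrainHat ξ M} := by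
  have h := continuous_potentialHat_apply ξ
  refine IsClosed.and (isClosed_eq (by fun_prop) continuous_const) ?_
  simp only [Set.ofPred_forall]
  exact isClosed_iInter fun p => isClosed_eq (by fun_prop) (by fun_prop)

theorem potentialHat_smul (ξ : E3) (c : ℂ) (M : CMat3) :
    potentialHat ξ (c • M) = c • potentialHat ξ M := by
  ext i
  simp only [potentialHat, PiLp.smul_apply, smul_eq_mul, mul_left_comm _ c, ← Finset.mul_sum]

theorem IsStrainHat.smul {ξ : E3} {M : CMat3} (h : IsStrainHat ξ M) (c : ℂ) :
    IsStrainHat ξ (c • M) := by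
  simp only [IsStrainHat, potentialHat_smul, PiLp.smul_apply, smul_eq_mul]
  refine ⟨?_, fun p => ?_⟩
  · simp only [mul_left_comm _ c, ← Finset.mul_sum, h.1, mul_zero]
  · rw [h.2 p]
    ring

theorem potentialHat_neg_conj (ξ : E3) (M : CMat3) (i : Fin 3) :
    potentialHat (-ξ) (conjMat M) i = starRingEnd ℂ (potentialHat ξ M i) := by
  simp [potentialHat]

/-- This puts the recovered potential in `Ḣ¹`. The constant is crude: a factor 3 for each of the two
index sums and a factor 2 from `2π/π`. -/
theorem norm_mul_potentialHat_le (ξ : E3) (M : CMat3) :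
    2 * Real.pi * ‖ξ‖ * ‖potentialHat ξ M‖ ≤ 18 * ‖M‖ := by
  rcases eq_or_ne ξ 0 with rfl | hξ
  · simp
  have hξ' : 0 < ‖ξ‖ := norm_pos_iff.2 hξ
  have hi : ∀ i, ‖potentialHat ξ M i‖ ≤ 3 * ‖M‖ / (Real.pi * ‖ξ‖) := by
    intro i
    have h1 : ‖∑ j, (ξ j : ℂ) * M (i, j)‖ ≤ 3 * (‖ξ‖ * ‖M‖) := by
      refine (norm_sum_le _ _).trans ?_
      refine (Finset.sum_le_sum (g := fun _ => ‖ξ‖ * ‖M‖) fun j _ => ?_).trans (by simp)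
      rw [norm_mul, Complex.norm_real]
      exact mul_le_mul (PiLp.norm_apply_le ξ j) (PiLp.norm_apply_le M (i, j)) (norm_nonneg _)
        (norm_nonneg _)
    have h2 : ‖potentialHat ξ M i‖ =
        (Real.pi * ‖ξ‖ ^ 2)⁻¹ * ‖∑ j, (ξ j : ℂ) * M (i, j)‖ := by
      simp only [potentialHat, norm_mul, norm_inv, Complex.norm_I, Complex.norm_real,
        norm_pow, abs_norm, Real.norm_eq_abs, abs_of_pos Real.pi_pos, mul_one]
    rw [h2]
    refine (mul_le_mul_of_nonneg_left h1 (by positivity)).trans (le_of_eq ?_)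
    field_simp
  have hs : ‖potentialHat ξ M‖ ≤ ∑ i, ‖potentialHat ξ M i‖ := by
    rw [EuclideanSpace.norm_eq]
    refine Real.sqrt_le_iff.2 ⟨by positivity, ?_⟩
    exact Finset.sum_sq_le_sq_sum_of_nonneg fun i _ => norm_nonneg _
  have h3 : ‖potentialHat ξ M‖ ≤ 9 * ‖M‖ / (Real.pi * ‖ξ‖) :=
    hs.trans ((Finset.sum_le_sum fun i _ => hi i).trans (le_of_eq (by simp; ring)))
  refine (mul_le_mul_of_nonneg_left h3 (by positivity)).trans (le_of_eq ?_)
  field_simp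
  ring

theorem ae_ne_zero : ∀ᵐ ξ : E3, ξ ≠ 0 := by
  simp [ae_iff]

/-- If `ξ · û = 0` then `Ŝ(ξ) ξ = πi|ξ|² û(ξ)`, so the potential is determined by `S` and the
existential over `u` becomes a linear condition at each frequency. -/
theorem mem_L2st_iff {S : L2Mat} : S ∈ L2st ↔ ∀ᵐ ξ, IsStrainHat ξ (fourierMat S ξ) := by
  constructor
  · rintro ⟨u, hu⟩
    filter_upwards [hu, u.div_free, ae_ne_zero] with ξ h1 h2 h3
    have key : ∀ i, potentialHat ξ (u.symGradHat ξ) i = u.hat ξ i := by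
      intro i
      have hn : ((‖ξ‖ ^ 2 : ℝ) : ℂ) = ∑ j, (ξ j : ℂ) ^ 2 := by
        rw [EuclideanSpace.norm_sq_eq]
        simp
      have hn0 : ((‖ξ‖ ^ 2 : ℝ) : ℂ) ≠ 0 := by
        exact_mod_cast pow_ne_zero 2 (norm_ne_zero_iff.2 h3)
      have hpi : (Real.pi : ℂ) ≠ 0 := by exact_mod_cast Real.pi_ne_zero
      simp only [potentialHat, HDotOneDivFree.symGradHat]
      have e : ∑ j, (ξ j : ℂ) * ((1 / 2 : ℂ) * (2 * Real.pi * Complex.I * ξ i * u.hat ξ j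
          + 2 * Real.pi * Complex.I * ξ j * u.hat ξ i)) =
          Real.pi * Complex.I * ((‖ξ‖ ^ 2 : ℝ) * u.hat ξ i) := by
        -- The cross term `ξ i * ∑ ξ j û j` vanishes by incompressibility; it is inserted here as a
        -- zero so that the two sums agree term by term.
        rw [hn, Finset.sum_mul, ← add_zero (∑ j, (ξ j : ℂ) ^ 2 * u.hat ξ i),
          ← mul_zero (ξ i : ℂ), ← h2, Finset.mul_sum, ← Finset.sum_add_distrib, Finset.mul_sum]
        refine Finset.sum_congr rfl fun j _ => ?_
        ring
      rw [e]
      field_simp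
    rw [h1]
    refine ⟨by simpa only [key] using h2, fun p => ?_⟩
    simp only [key]
    rfl
  · intro h
    have hm := (Lp.memLp (fourierMat S)).1
    refine ⟨⟨fun ξ => potentialHat ξ (fourierMat S ξ), ?_, ?_, ?_, ?_⟩, ?_⟩
    · refine (PiLp.continuous_toLp 2 _).comp_aestronglyMeasurable ?_
      refine (aemeasurable_pi_lambda _ fun i => ?_).aestronglyMeasurable
      have hp : ∀ p, AEMeasurable (fun ξ => fourierMat S ξ p) volume := fun p =>
        ((EuclideanSpace.proj (𝕜 := ℂ) p).continuous.comp_aestronglyMeasurable hm).aemeasurable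
      fun_prop
    · have hfin : ∫⁻ ξ, ‖fourierMat S ξ‖ₑ ^ 2 < ⊤ := by
        simpa using (eLpNorm_lt_top_iff_lintegral_rpow_enorm_lt_top two_ne_zero
          ENNReal.ofNat_ne_top).1 (Lp.memLp (fourierMat S)).2
      refine lt_of_le_of_lt (lintegral_mono (g := fun ξ => 18 ^ 2 * ‖fourierMat S ξ‖ₑ ^ 2)
        fun ξ => ?_) ?_
      · have h18 := ENNReal.ofReal_le_ofReal (norm_mul_potentialHat_le ξ (fourierMat S ξ))
        rw [ENNReal.ofReal_mul (by positivity), ENNReal.ofReal_mul (by norm_num : (0 : ℝ) ≤ 18),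
          ofReal_norm, ofReal_norm, ENNReal.ofReal_ofNat] at h18
        have := pow_le_pow_left' h18 2
        rwa [mul_pow, mul_pow, ← ENNReal.ofReal_pow (by positivity)] at this
      · rw [lintegral_const_mul' _ _ (by simp)]
        exact ENNReal.mul_lt_top (by simp) hfin
    -- Reality of the potential comes from the Hermitian symmetry of `Ŝ`: the odd factor `ξ j` and
    -- the conjugate of `i` each change sign.
    · have hr := reflectL2_fourierMat S
      filter_upwards [coeFn_reflectL2 (fourierMat S), coeFn_conjL2 (fourierMat S)] with ξ a b i
      rw [hr, b] at a
      simp only [← a, potentialHat_neg_conj]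
    · filter_upwards [h] with ξ hξ using hξ.1
    · filter_upwards [h] with ξ hξ
      ext p
      exact hξ.2 p

/-- An `L²` limit is an almost everywhere limit of the transforms along a subsequence, and the
constraint is closed at each fixed frequency. -/
theorem isClosed_L2st : IsClosed (L2st : Set L2Mat) := by
  refine IsSeqClosed.isClosed fun u S hu hS => ?_
  have h1 : Tendsto (fun n => fourierMat (u n)) atTop (𝓝 (fourierMat S)) :=
    (continuous_fourierMat.tendsto S).comp hS
  obtain ⟨φ, -, hφ⟩ := (tendstoInMeasure_of_tendsto_Lp h1).exists_seq_tendsto_ae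
  refine mem_L2st_iff.2 ?_
  filter_upwards [hφ, ae_all_iff.2 fun n => mem_L2st_iff.1 (hu n)] with ξ a b
  exact (isClosed_isStrainHat ξ).mem_of_tendsto a (Eventually.of_forall fun n => b (φ n))

theorem mem_L2st_of_fourierMat_ae_eq_smul {S T : L2Mat} (hS : S ∈ L2st) {c : E3 → ℂ}
    (h : fourierMat T =ᵐ[volume] fun ξ => c ξ • fourierMat S ξ) : T ∈ L2st := by
  rw [mem_L2st_iff] at hS ⊢
  filter_upwards [hS, h] with ξ a b
  rw [b]
  exact a.smul _

theorem topologicalClosure_L2st : L2st.topologicalClosure = L2st :=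
  isClosed_L2st.submodule_topologicalClosure_eq

theorem Pst_mem (S : L2Mat) : Pst S ∈ L2st :=
  topologicalClosure_L2st.le (Submodule.starProjection_apply_mem L2st.topologicalClosure S)

theorem norm_Pst_le (S : L2Mat) : ‖Pst S‖ ≤ ‖S‖ :=
  Submodule.norm_starProjection_apply_le _ S

/-- A symmetric operator that preserves `L²_st` commutes with the projection. -/
theorem Pst_comm {A : L2Mat →L[ℝ] L2Mat} (hA : ∀ S ∈ L2st, A S ∈ L2st)
    (hs : ∀ S T, inner ℝ (A S) T = inner ℝ S (A T)) (S : L2Mat) : Pst (A S) = A (Pst S) := by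
  refine Submodule.eq_starProjection_of_mem_of_inner_eq_zero ?_ fun w hw => ?_
  · exact L2st.le_topologicalClosure (hA _ (Pst_mem S))
  · rw [← map_sub, hs]
    exact Submodule.starProjection_inner_eq_zero S (A w)
      (L2st.le_topologicalClosure (hA w (topologicalClosure_L2st.le hw)))

theorem fourierMul_mem {m : E3 → ℝ} (hm : MemLp m ∞) (he : ∀ ξ, m (-ξ) = m ξ) {S : L2Mat}
    (hS : S ∈ L2st) : fourierMul m hm S ∈ L2st :=
  mem_L2st_of_fourierMat_ae_eq_smul hS (fourierMat_fourierMul hm he S)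

theorem Pst_fourierMul {m : E3 → ℝ} (hm : MemLp m ∞) (he : ∀ ξ, m (-ξ) = m ξ) (S : L2Mat) :
    Pst (fourierMul m hm S) = fourierMul m hm (Pst S) :=
  Pst_comm (fun _ => fourierMul_mem hm he) (inner_fourierMul hm he) S

/-! ### Matrix products -/

/-- The product of `3 × 3` matrices as a bounded bilinear map for the Frobenius norm. -/
noncomputable def matMul (𝕜 : Type*) [RCLike 𝕜] : EuclideanSpace 𝕜 (Fin 3 × Fin 3) →L[𝕜]
    EuclideanSpace 𝕜 (Fin 3 × Fin 3) →L[𝕜] EuclideanSpace 𝕜 (Fin 3 × Fin 3) :=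
  LinearMap.mkContinuous₂
    (LinearMap.mk₂ 𝕜 (fun A B => WithLp.toLp 2 fun p => ∑ k, A (p.1, k) * B (k, p.2))
      (fun A B C => by ext p; simp [add_mul, Finset.sum_add_distrib])
      (fun c A B => by ext p; simp [Finset.mul_sum, mul_assoc])
      (fun A B C => by ext p; simp [mul_add, Finset.sum_add_distrib])
      (fun c A B => by ext p; simp [Finset.mul_sum, mul_left_comm])) 1 fun A B => by
    rw [one_mul]
    refine le_of_sq_le_sq ?_ (by positivity)
    rw [mul_pow, EuclideanSpace.norm_sq_eq, EuclideanSpace.norm_sq_eq, EuclideanSpace.norm_sq_eq]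
    -- Cauchy–Schwarz in each entry, summed over entries. The resulting constant 1 enters the
    -- existence time.
    have h : ∀ p : Fin 3 × Fin 3, ‖∑ k, A (p.1, k) * B (k, p.2)‖ ^ 2 ≤
        (∑ k, ‖A (p.1, k)‖ ^ 2) * ∑ k, ‖B (k, p.2)‖ ^ 2 := fun p => by
      refine (pow_le_pow_left₀ (norm_nonneg _) (norm_sum_le _ _) 2).trans ?_
      simp only [norm_mul]
      exact Finset.sum_mul_sq_le_sq_mul_sq _ _ _
    refine (Finset.sum_le_sum fun p _ => h p).trans (le_of_eq ?_)
    rw [Fintype.sum_prod_type, Fintype.sum_prod_type, Fintype.sum_prod_type, Finset.sum_mul_sum]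
    simp only
    refine Finset.sum_congr rfl fun i _ => ?_
    rw [← Finset.mul_sum, ← Finset.mul_sum, Finset.sum_comm]

theorem matMul_apply {𝕜 : Type*} [RCLike 𝕜] (A B : EuclideanSpace 𝕜 (Fin 3 × Fin 3))
    (p : Fin 3 × Fin 3) : matMul 𝕜 A B p = ∑ k, A (p.1, k) * B (k, p.2) := rfl

theorem norm_matMul_opNorm_le (𝕜 : Type*) [RCLike 𝕜] : ‖matMul 𝕜‖ ≤ 1 :=
  LinearMap.mkContinuous₂_norm_le _ zero_le_one _

theorem norm_matMul_le {𝕜 : Type*} [RCLike 𝕜] (A B : EuclideanSpace 𝕜 (Fin 3 × Fin 3)) :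
    ‖matMul 𝕜 A B‖ ≤ ‖A‖ * ‖B‖ := by
  have h := (matMul 𝕜).le_opNorm₂ A B
  have h1 := norm_matMul_opNorm_le 𝕜
  calc _ ≤ _ := h
    _ ≤ 1 * ‖A‖ * ‖B‖ := by gcongr
    _ = _ := by ring

/-- The product of two matrix fields in `L²`, an element of `L¹`. -/
noncomputable def mulL1 (S T : L2Mat) : Lp Mat3 1 (volume : Measure E3) :=
  (matMul ℝ).holder 1 S T

theorem norm_mulL1_le (S T : L2Mat) : ‖mulL1 S T‖ ≤ ‖S‖ * ‖T‖ := by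
  have h := (matMul ℝ).norm_holder_apply_apply_le (r := 1) S T
  have h1 := norm_matMul_opNorm_le ℝ
  calc _ ≤ _ := h
    _ ≤ 1 * ‖S‖ * ‖T‖ := by gcongr
    _ = _ := by ring

theorem sqL1_eq (S : L2Mat) : sqL1 S = mulL1 S S := by
  ext1
  filter_upwards [(memLp_matSq S).coeFn_toLp, (matMul ℝ).coeFn_holder (r := 1) S S] with x a b
  exact a.trans b.symm

/-- Matrices do not commute, so the difference of squares telescopes through the mixed product `S
T`. -/
theorem sqL1_sub (S T : L2Mat) : sqL1 S - sqL1 T = mulL1 S (S - T) + mulL1 (S - T) T := by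
  rw [sqL1_eq, sqL1_eq, sub_eq_add_neg S T, ← neg_one_smul ℝ T]
  unfold mulL1
  rw [ContinuousLinearMap.holder_add_right, ContinuousLinearMap.holder_add_left,
    ContinuousLinearMap.holder_smul_right, ContinuousLinearMap.holder_smul_left]
  module

theorem norm_sqL1_sub_le (S T : L2Mat) : ‖sqL1 S - sqL1 T‖ ≤ (‖S‖ + ‖T‖) * ‖S - T‖ := by
  rw [sqL1_sub]
  refine (norm_add_le _ _).trans ((add_le_add (norm_mulL1_le _ _) (norm_mulL1_le _ _)).trans ?_)
  exact le_of_eq (by ring)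

theorem norm_sqL1_le (S : L2Mat) : ‖sqL1 S‖ ≤ ‖S‖ ^ 2 := by
  rw [sqL1_eq, sq]
  exact norm_mulL1_le S S

/-! ### The heat semigroup -/

/-- The symbol `exp (-t (2π|ξ|)²)` of the heat semigroup. -/
noncomputable def heatSymbol (t : ℝ) (ξ : E3) : ℝ := Real.exp (-t * (2 * Real.pi * ‖ξ‖) ^ 2)

theorem fourier_heatKernel {t : ℝ} (ht : 0 < t) (ξ : E3) :
    𝓕 (fun x : E3 => (heatKernel t x : ℂ)) ξ = heatSymbol t ξ := by
  have hb : 0 < ((1 / (4 * t) : ℝ) : ℂ).re := by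
    rw [Complex.ofReal_re]
    positivity
  have h := fourier_gaussian_innerProductSpace (V := E3) hb ξ
  have e : (fun x : E3 => (heatKernel t x : ℂ)) = fun x : E3 =>
      ((1 / (4 * Real.pi * t) ^ (3 / 2 : ℝ) : ℝ) : ℂ) •
        Complex.exp (-((1 / (4 * t) : ℝ) : ℂ) * (‖x‖ : ℂ) ^ 2) := by
    funext x
    simp only [heatKernel, smul_eq_mul]
    push_cast
    congr 2
    ring
  have hs : ∀ (c : ℂ) (F : E3 → ℂ), 𝓕 (fun x => c • F x) ξ = c • 𝓕 F ξ := fun c F => by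
    simp only [Real.fourier_eq, smul_comm _ c, integral_smul]
  rw [e, hs, h]
  have e2 : (Real.pi : ℂ) / ((1 / (4 * t) : ℝ) : ℂ) = ((4 * Real.pi * t : ℝ) : ℂ) := by
    push_cast
    field_simp
  have e3 : ((Module.finrank ℝ E3 : ℕ) : ℂ) / 2 = ((3 / 2 : ℝ) : ℂ) := by simp
  rw [e2, e3, ← Complex.ofReal_cpow (by positivity), smul_eq_mul, ← mul_assoc,
    ← Complex.ofReal_mul, one_div_mul_cancel (by positivity), Complex.ofReal_one, one_mul,
    heatSymbol, Complex.ofReal_exp]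
  congr 1
  push_cast
  field_simp
  ring

/-! ### The `L²` norm of the heat kernel -/

theorem eLpNorm_two_sq {F : Type*} [NormedAddCommGroup F] (f : E3 → F) :
    eLpNorm f 2 volume ^ 2 = ∫⁻ x, ‖f x‖ₑ ^ 2 := by
  simpa using eLpNorm_nnreal_pow_eq_lintegral (μ := (volume : Measure E3)) (f := f) (p := 2) (by simp)

/-- The square of the kernel is again Gaussian, with integral `(8πt)^{-3/2}`. The exponent `-3/4`
exceeds `-1`, which is why Duhamel's integral converges. -/
theorem eLpNorm_heatKernel {t : ℝ} (ht : 0 < t) : eLpNorm (heatKernel t) 2 volume =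
    ENNReal.ofReal ((8 * Real.pi) ^ (-(3 / 4) : ℝ) * t ^ (-(3 / 4) : ℝ)) := by
  have hm := (memLp_heatKernel ht).2
  have h1 : eLpNorm (heatKernel t) 2 volume ^ 2 =
      ENNReal.ofReal ((8 * Real.pi) ^ (-(3 / 4) : ℝ) * t ^ (-(3 / 4) : ℝ)) ^ 2 := by
    rw [eLpNorm_two_sq, ← ENNReal.ofReal_pow (by positivity)]
    have hi : Integrable fun x => heatKernel t x ^ 2 := hm.integrable_sq
    have e : ∀ x, ‖heatKernel t x‖ₑ ^ 2 = ENNReal.ofReal (heatKernel t x ^ 2) := fun x => by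
      rw [← ofReal_norm, ← ENNReal.ofReal_pow (norm_nonneg _), Real.norm_eq_abs, sq_abs]
    simp only [e]
    rw [← ofReal_integral_eq_lintegral_ofReal hi (Eventually.of_forall fun x => sq_nonneg _)]
    congr 1
    have e2 : (fun x : E3 => heatKernel t x ^ 2) = fun x : E3 =>
        ((1 / (4 * Real.pi * t) ^ (3 / 2 : ℝ)) ^ 2) * Real.exp (-(1 / (2 * t)) * ‖x‖ ^ 2) := by
      funext x
      simp only [heatKernel, mul_pow, ← Real.exp_nat_mul]
      congr 2
      push_cast
      field_simp
      ring
    rw [e2, integral_const_mul, GaussianFourier.integral_rexp_neg_mul_sq_norm (by positivity)]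
    have e3 : ((Module.finrank ℝ E3 : ℕ) : ℝ) / 2 = 3 / 2 := by simp
    -- Written this way, the power of `4πt` cancels the squared prefactor of the kernel.
    have e4 : Real.pi / (1 / (2 * t)) = (4 * Real.pi * t) ^ 2 * (8 * Real.pi * t)⁻¹ := by
      field_simp
      ring
    have e5 : ∀ a b : ℝ, 0 < a → 0 < b →
        (1 / a ^ (3 / 2 : ℝ)) ^ 2 * (a ^ 2 * b⁻¹) ^ (3 / 2 : ℝ) = (b ^ (-(3 / 4) : ℝ)) ^ 2 := by
      intro a b ha hb
      rw [Real.mul_rpow (by positivity) (by positivity), ← Real.rpow_natCast a,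
        ← Real.rpow_mul ha.le, Real.inv_rpow hb.le, ← Real.rpow_neg hb.le,
        ← Real.rpow_natCast (b ^ _), ← Real.rpow_mul hb.le, div_pow, one_pow,
        ← Real.rpow_natCast (a ^ _), ← Real.rpow_mul ha.le]
      norm_num
      rw [← mul_assoc, inv_mul_cancel₀ (by positivity), one_mul]
    rw [e3, e4, e5 _ _ (by positivity) (by positivity), Real.mul_rpow (by positivity) ht.le]
  exact (ENNReal.pow_right_strictMono two_ne_zero).injective h1

theorem gaussianProfile_eq : gaussianProfile = heatKernel 1 := by
  funext x
  simp [gaussianProfile, heatKernel]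

theorem eLpNorm_gaussianProfile :
    eLpNorm gaussianProfile 2 volume = ENNReal.ofReal ((8 * Real.pi) ^ (-(3 / 4) : ℝ)) := by
  rw [gaussianProfile_eq, eLpNorm_heatKernel one_pos]
  simp

/-- `‖g‖_{L²}` as a real number. -/
noncomputable def gaussNorm : ℝ := (8 * Real.pi) ^ (-(3 / 4) : ℝ)

theorem gaussNorm_pos : 0 < gaussNorm := by
  unfold gaussNorm
  positivity

/-! ### The convolution theorem and Young's inequality -/

/-- `complexify` as a linear isometry. -/
noncomputable def complexifyLI : Mat3 →ₗᵢ[ℝ] CMat3 where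
  toLinearMap := complexify.toLinearMap
  norm_map' := norm_complexify

theorem complexify_heatConv (t : ℝ) (f : E3 → Mat3) (x : E3) : complexify (heatConv t f x) =
    convolution (fun x => (heatKernel t x : ℂ)) (fun x => complexify (f x))
      (ContinuousLinearMap.lsmul ℂ ℂ) volume x := by
  have h := complexifyLI.integral_comp_comm (μ := (volume : Measure E3))
    (fun y => heatKernel t y • f (x - y))
  change _ = complexify (heatConv t f x) at h
  rw [← h, convolution_def]
  refine integral_congr_ae (Eventually.of_forall fun y => ?_)
  change complexify _ = _
  rw [map_smul]
  ext p
  simp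

/-- Only `f ∈ L¹` is assumed, besides square integrability of the convolution. Hence this covers
`heatL1` directly and `heatL2` on a dense set. -/
theorem fourier_heatConv {t : ℝ} (ht : 0 < t) {f : E3 → Mat3} (hf : Integrable f)
    (h2 : MemLp (heatConv t f) 2) :
    fourierMat (h2.toLp _) =ᵐ[volume]
      fun ξ => (heatSymbol t ξ : ℂ) • 𝓕 (fun x => complexify (f x)) ξ := by
  have hk : Integrable fun x : E3 => (heatKernel t x : ℂ) :=
    (memLp_one_iff_integrable.1 (memLp_heatKernel ht).1).ofReal
  have hf' : Integrable fun x => complexify (f x) := complexify.integrable_comp hf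
  have e : (fun x => complexify (heatConv t f x)) =
      convolution (fun x => (heatKernel t x : ℂ)) (fun x => complexify (f x))
      (ContinuousLinearMap.lsmul ℂ ℂ) volume := funext (complexify_heatConv t f)
  have h1 : Integrable fun x => complexify (heatConv t f x) := by
    rw [e]
    exact hk.integrable_convolution _ hf'
  have h2' : MemLp (fun x => complexify (heatConv t f x)) 2 := complexify.comp_memLp' h2
  have e2 : complexify.compLp (h2.toLp _) = h2'.toLp _ := by
    ext1
    filter_upwards [complexify.coeFn_compLp (h2.toLp _), h2.coeFn_toLp, h2'.coeFn_toLp]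
      with x a b c
    rw [a, b, c]
  unfold fourierMat
  rw [e2]
  filter_upwards [fourier_toLp_ae_eq h1 h2'] with ξ hξ
  rw [hξ, e, Real.fourier_smul_convolution_eq hk hf', fourier_heatKernel ht]

theorem enorm_heatConv_le (t : ℝ) (f : E3 → Mat3) (x : E3) :
    ‖heatConv t f x‖ₑ ≤ ∫⁻ y, ‖heatKernel t y‖ₑ * ‖f (x - y)‖ₑ := by
  refine (enorm_integral_le_lintegral_enorm _).trans (le_of_eq ?_)
  simp only [enorm_smul]

theorem eLpNorm_heatConv_le_of_memLp_two {t : ℝ} (ht : 0 < t) {f : E3 → Mat3} (hf : MemLp f 2) :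
    eLpNorm (heatConv t f) 2 volume ≤
      eLpNorm (heatKernel t) 1 volume * eLpNorm f 2 volume := by
  refine (ENNReal.pow_le_pow_left_iff two_ne_zero).1 ?_
  rw [mul_pow, eLpNorm_two_sq, eLpNorm_two_sq, eLpNorm_one_eq_lintegral_enorm]
  exact (lintegral_mono fun x => pow_le_pow_left' (enorm_heatConv_le t f x) 2).trans
    (lintegral_conv_sq_le (memLp_heatKernel ht).1.1.enorm hf.1.enorm)

/-- Young's inequality with the datum as the `L¹` factor and the kernel as the `L²` factor; the
substitution `y ↦ x - y` exchanges their roles. -/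
theorem eLpNorm_heatConv_le_of_memLp_one {t : ℝ} (ht : 0 < t) {f : E3 → Mat3} (hf : MemLp f 1) :
    eLpNorm (heatConv t f) 2 volume ≤
      eLpNorm (heatKernel t) 2 volume * eLpNorm f 1 volume := by
  refine (ENNReal.pow_le_pow_left_iff two_ne_zero).1 ?_
  rw [mul_pow, eLpNorm_two_sq, eLpNorm_two_sq, eLpNorm_one_eq_lintegral_enorm, mul_comm]
  refine le_trans (lintegral_mono fun x => ?_)
    (lintegral_conv_sq_le hf.1.enorm (memLp_heatKernel ht).2.1.enorm)
  refine pow_le_pow_left' ((enorm_heatConv_le t f x).trans (le_of_eq ?_)) 2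
  rw [← lintegral_sub_left_eq_self _ x]
  simp only [sub_sub_cancel, mul_comm]

theorem heatConv_sub {t : ℝ} (ht : 0 < t) {f g : E3 → Mat3} (hf : MemLp f 2) (hg : MemLp g 2) :
    heatConv t (f - g) = heatConv t f - heatConv t g := by
  have h : ∀ {f : E3 → Mat3}, MemLp f 2 → ∀ x, Integrable fun y => heatKernel t y • f (x - y) := by
    intro f hf x
    have hf' : MemLp (fun y => f (x - y)) 2 :=
      hf.comp_measurePreserving (Measure.measurePreserving_sub_left volume x)
    exact memLp_one_iff_integrable.1 (hf'.smul (memLp_heatKernel ht).2)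
  funext x
  simp only [heatConv, Pi.sub_apply, smul_sub]
  exact integral_sub (h hf x) (h hg x)

theorem heatL2_of_pos {t : ℝ} (ht : 0 < t) (S : L2Mat) :
    heatL2 t S = (memLp_heatConv_of_memLp_two ht (Lp.memLp S)).toLp _ := by
  rw [heatL2, dif_pos ht]

theorem heatL1_of_pos {t : ℝ} (ht : 0 < t) (F : Lp Mat3 1 (volume : Measure E3)) :
    heatL1 t F = (memLp_heatConv_of_memLp_one ht (Lp.memLp F)).toLp _ := by
  rw [heatL1, dif_pos ht]

theorem heatConv_congr {t : ℝ} {f g : E3 → Mat3} (h : f =ᵐ[volume] g) :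
    heatConv t f = heatConv t g := by
  funext x
  refine integral_congr_ae ?_
  filter_upwards [(Measure.measurePreserving_sub_left volume x).quasiMeasurePreserving.ae_eq_comp h]
    with y hy
  simp only [Function.comp_apply] at hy
  rw [hy]

theorem continuous_heatL2_right {t : ℝ} (ht : 0 < t) : Continuous (heatL2 t) := by
  have hfin : eLpNorm (heatKernel t) 1 volume ≠ ⊤ := (memLp_heatKernel ht).1.2.ne
  refine (LipschitzWith.of_dist_le_mul (K := (eLpNorm (heatKernel t) 1 volume).toNNReal)
    fun S T => ?_).continuous
  rw [dist_eq_norm, dist_eq_norm, heatL2_of_pos ht, heatL2_of_pos ht, ← MemLp.toLp_sub,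
    Lp.norm_toLp, Lp.norm_def]
  rw [← heatConv_sub ht (Lp.memLp S) (Lp.memLp T), ← heatConv_congr (Lp.coeFn_sub S T)]
  have h := eLpNorm_heatConv_le_of_memLp_two ht (Lp.memLp (S - T))
  refine (ENNReal.toReal_mono (ENNReal.mul_ne_top hfin (Lp.memLp _).2.ne) h).trans (le_of_eq ?_)
  rw [ENNReal.toReal_mul]
  rfl

/-! ### The heat semigroup as a Fourier multiplier -/

theorem continuous_heatSymbol (t : ℝ) : Continuous (heatSymbol t) := by
  unfold heatSymbol
  fun_prop

theorem heatSymbol_nonneg (t : ℝ) (ξ : E3) : 0 ≤ heatSymbol t ξ := (Real.exp_pos _).le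

theorem heatSymbol_le_one {t : ℝ} (ht : 0 ≤ t) (ξ : E3) : heatSymbol t ξ ≤ 1 := by
  refine Real.exp_le_one_iff.2 ?_
  have := mul_nonneg ht (sq_nonneg (2 * Real.pi * ‖ξ‖))
  linarith

theorem heatSymbol_neg (t : ℝ) (ξ : E3) : heatSymbol t (-ξ) = heatSymbol t ξ := by
  simp [heatSymbol]

theorem heatSymbol_add (s t : ℝ) (ξ : E3) :
    heatSymbol (s + t) ξ = heatSymbol s ξ * heatSymbol t ξ := by
  rw [heatSymbol, heatSymbol, heatSymbol, ← Real.exp_add]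
  congr 1
  ring

theorem memLp_heatSymbol {t : ℝ} (ht : 0 ≤ t) : MemLp (heatSymbol t) ∞ :=
  memLp_top_of_bound (continuous_heatSymbol t).aestronglyMeasurable 1 (Eventually.of_forall fun ξ =>
    (Real.norm_of_nonneg (heatSymbol_nonneg t ξ)).le.trans (heatSymbol_le_one ht ξ))

/-- For `t > 0` both sides are continuous in `S` and agree on `L¹ ∩ L²` by the convolution theorem;
at `t = 0` the symbol is 1. Contractivity, linearity and invariance of `L²_st` are then read off
from the symbol. -/
theorem heatL2_eq_fourierMul {t : ℝ} (ht : 0 ≤ t) (S : L2Mat) :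
    heatL2 t S = fourierMul _ (memLp_heatSymbol ht) S := by
  rcases ht.eq_or_lt with rfl | ht'
  · refine fourierMat_injective ?_
    ext1
    filter_upwards [fourierMat_fourierMul (memLp_heatSymbol ht) (heatSymbol_neg 0) S] with ξ a
    rw [a]
    simp [heatL2, heatSymbol]
  refine Lp_two_induction (P := fun S : L2Mat => heatL2 t S = fourierMul _ (memLp_heatSymbol ht) S)
    (isClosed_eq (continuous_heatL2_right ht') (fourierMul _ _).continuous) (fun f h1 h2 => ?_) S
  refine fourierMat_injective ?_
  have h2' : MemLp (fun x => complexify (f x)) 2 := complexify.comp_memLp' h2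
  have hc : MemLp (heatConv t f) 2 := memLp_heatConv_of_memLp_two ht' h2
  have e : heatL2 t (h2.toLp f) = hc.toLp _ := by
    rw [heatL2_of_pos ht']
    simp only [heatConv_congr h2.coeFn_toLp]
  have e2 : complexify.compLp (h2.toLp f) = h2'.toLp _ := by
    ext1
    filter_upwards [complexify.coeFn_compLp (h2.toLp _), h2.coeFn_toLp, h2'.coeFn_toLp]
      with x a b c
    rw [a, b, c]
  rw [e]
  ext1
  filter_upwards [fourier_heatConv ht' h1 hc, fourierMat_fourierMul (memLp_heatSymbol ht)
    (heatSymbol_neg t) (h2.toLp f), fourier_toLp_ae_eq (complexify.integrable_comp h1) h2']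
    with ξ a b c
  rw [a, b, fourierMat, e2, c]

theorem fourierMat_heatL2 {t : ℝ} (ht : 0 ≤ t) (S : L2Mat) :
    fourierMat (heatL2 t S) =ᵐ[volume] fun ξ => (heatSymbol t ξ : ℂ) • fourierMat S ξ := by
  rw [heatL2_eq_fourierMul ht]
  exact fourierMat_fourierMul _ (heatSymbol_neg t) S

theorem fourierMat_heatL1 {t : ℝ} (ht : 0 < t) (F : Lp Mat3 1 (volume : Measure E3)) :
    fourierMat (heatL1 t F) =ᵐ[volume]
      fun ξ => (heatSymbol t ξ : ℂ) • 𝓕 (fun x => complexify (F x)) ξ := by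
  rw [heatL1_of_pos ht]
  exact fourier_heatConv ht (memLp_one_iff_integrable.1 (Lp.memLp F)) _

/-- The smoothing estimate on which existence and uniqueness rest, with the sharp kernel norm that
appears in `existenceConst`. -/
theorem norm_heatL1_le {t : ℝ} (ht : 0 < t) (F : Lp Mat3 1 (volume : Measure E3)) :
    ‖heatL1 t F‖ ≤ gaussNorm * t ^ (-(3 / 4) : ℝ) * ‖F‖ := by
  rw [heatL1_of_pos ht, Lp.norm_toLp, Lp.norm_def]
  have h := eLpNorm_heatConv_le_of_memLp_one ht (Lp.memLp F)
  rw [eLpNorm_heatKernel ht] at h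
  refine (ENNReal.toReal_mono (ENNReal.mul_ne_top ENNReal.ofReal_ne_top (Lp.memLp _).2.ne) h).trans
    (le_of_eq ?_)
  rw [ENNReal.toReal_mul, ENNReal.toReal_ofReal (by positivity)]
  rfl

theorem heatL1_sub {t : ℝ} (ht : 0 < t) (F G : Lp Mat3 1 (volume : Measure E3)) :
    heatL1 t (F - G) = heatL1 t F - heatL1 t G := by
  refine fourierMat_injective ?_
  rw [fourierMat_sub]
  ext1
  have hi : ∀ F : Lp Mat3 1 (volume : Measure E3), Integrable fun x => complexify (F x) :=
    fun F => complexify.integrable_comp (memLp_one_iff_integrable.1 (Lp.memLp F))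
  filter_upwards [fourierMat_heatL1 ht (F - G), fourierMat_heatL1 ht F, fourierMat_heatL1 ht G,
    Lp.coeFn_sub (fourierMat (heatL1 t F)) (fourierMat (heatL1 t G))] with ξ a b c d
  rw [a, d, Pi.sub_apply, b, c, ← smul_sub]
  congr 1
  rw [Real.fourier_eq, Real.fourier_eq, Real.fourier_eq, ← integral_sub
    ((Real.fourierIntegral_convergent_iff (μ := volume) ξ).2 (hi F))
    ((Real.fourierIntegral_convergent_iff (μ := volume) ξ).2 (hi G))]
  refine integral_congr_ae ?_
  filter_upwards [Lp.coeFn_sub F G] with x hx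
  rw [hx, Pi.sub_apply, map_sub, smul_sub]

theorem heatL1_add_time {s t : ℝ} (hs : 0 ≤ s) (ht : 0 < t) (F : Lp Mat3 1 (volume : Measure E3)) :
    heatL1 (s + t) F = heatL2 s (heatL1 t F) := by
  refine fourierMat_injective ?_
  ext1
  filter_upwards [fourierMat_heatL1 (add_pos_of_nonneg_of_pos hs ht) F, fourierMat_heatL1 ht F,
    fourierMat_heatL2 hs (heatL1 t F)] with ξ a b c
  rw [a, c, b, smul_smul, heatSymbol_add, Complex.ofReal_mul]

theorem norm_fourierMul_le {m : E3 → ℝ} (hm : MemLp m ∞) (he : ∀ ξ, m (-ξ) = m ξ) {c : ℝ}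
    (hc : 0 ≤ c) (h : ∀ ξ, |m ξ| ≤ c) (S : L2Mat) : ‖fourierMul m hm S‖ ≤ c * ‖S‖ := by
  rw [← norm_fourierMat, ← norm_fourierMat S, ← Real.norm_of_nonneg hc, ← norm_smul]
  refine Lp.norm_le_norm_of_ae_le ?_
  filter_upwards [fourierMat_fourierMul hm he S, Lp.coeFn_smul c (fourierMat S)] with ξ a b
  rw [a, b, Pi.smul_apply, norm_smul, norm_smul, Complex.norm_real, Real.norm_of_nonneg hc]
  exact mul_le_mul_of_nonneg_right (h ξ) (norm_nonneg _)

theorem norm_heatL2_le {t : ℝ} (ht : 0 ≤ t) (S : L2Mat) : ‖heatL2 t S‖ ≤ ‖S‖ := by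
  rw [heatL2_eq_fourierMul ht]
  refine (norm_fourierMul_le _ (heatSymbol_neg t) zero_le_one (fun ξ => ?_) S).trans (by simp)
  rw [abs_of_nonneg (heatSymbol_nonneg t ξ)]
  exact heatSymbol_le_one ht ξ

theorem heatL2_sub {t : ℝ} (ht : 0 ≤ t) (S T : L2Mat) :
    heatL2 t (S - T) = heatL2 t S - heatL2 t T := by
  simp only [heatL2_eq_fourierMul ht, map_sub]

theorem heatL2_mem {t : ℝ} (ht : 0 ≤ t) {S : L2Mat} (hS : S ∈ L2st) : heatL2 t S ∈ L2st := by
  rw [heatL2_eq_fourierMul ht]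
  exact fourierMul_mem _ (heatSymbol_neg t) hS

theorem norm_sq_L2 {F : Type*} [NormedAddCommGroup F] (f : Lp F 2 (volume : Measure E3)) :
    ENNReal.ofReal (‖f‖ ^ 2) = ∫⁻ x, ‖f x‖ₑ ^ 2 := by
  rw [← eLpNorm_two_sq, ENNReal.ofReal_pow (norm_nonneg _), Lp.norm_def,
    ENNReal.ofReal_toReal (Lp.memLp f).2.ne]

/-- The heat semigroup is strongly continuous. -/
theorem continuousOn_heatL2_left (S : L2Mat) : ContinuousOn (fun t => heatL2 t S) (Set.Ici 0) := by
  intro t ht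
  rw [ContinuousWithinAt, tendsto_iff_norm_sub_tendsto_zero]
  have h : Tendsto (fun s => ENNReal.ofReal (‖heatL2 s S - heatL2 t S‖ ^ 2)) (𝓝[Set.Ici 0] t)
      (𝓝 0) := by
    have hfin : ∫⁻ ξ, ‖fourierMat S ξ‖ₑ ^ 2 ≠ ⊤ := by
      rw [← norm_sq_L2]
      exact ENNReal.ofReal_ne_top
    have hm : AEMeasurable (fun ξ => ‖fourierMat S ξ‖ₑ ^ 2) volume :=
      (Lp.aestronglyMeasurable (fourierMat S)).enorm.pow_const 2
    -- Dominated convergence after Plancherel: both symbols lie in `[0, 1]`, so `|Ŝ|²` is a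
    -- majorant.
    have h1 : Tendsto (fun s => ∫⁻ ξ, ‖heatSymbol s ξ - heatSymbol t ξ‖ₑ ^ 2 *
        ‖fourierMat S ξ‖ₑ ^ 2) (𝓝[Set.Ici 0] t) (𝓝 (∫⁻ _ : E3, 0)) := by
      refine tendsto_lintegral_filter_of_dominated_convergence' (fun ξ => ‖fourierMat S ξ‖ₑ ^ 2)
        (Eventually.of_forall fun s => ?_) ?_ hfin (Eventually.of_forall fun ξ => ?_)
      · exact (((continuous_heatSymbol s).sub (continuous_heatSymbol t)).enorm.measurable.pow_const
          2).aemeasurable.mul hm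
      · filter_upwards [self_mem_nhdsWithin] with s hs
        refine Eventually.of_forall fun ξ => mul_le_of_le_one_left' (pow_le_one₀ (by simp) ?_)
        rw [← ofReal_norm, ← ENNReal.ofReal_one]
        refine ENNReal.ofReal_le_ofReal (abs_sub_le_iff.2 ⟨?_, ?_⟩) <;>
        linarith [heatSymbol_nonneg s ξ, heatSymbol_nonneg t ξ, heatSymbol_le_one hs ξ,
          heatSymbol_le_one ht ξ]
      · have hc : Continuous fun s => ‖heatSymbol s ξ - heatSymbol t ξ‖ₑ := by
          unfold heatSymbol
          fun_prop
        have h0 : Tendsto (fun s => ‖heatSymbol s ξ - heatSymbol t ξ‖ₑ ^ 2) (𝓝[Set.Ici 0] t)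
            (𝓝 0) := by
          simpa [Function.comp_def] using
            (((ENNReal.continuous_pow 2).comp hc).tendsto t).mono_left nhdsWithin_le_nhds
        simpa using ENNReal.Tendsto.mul_const h0 (Or.inr (by simp))
    rw [lintegral_zero] at h1
    refine h1.congr' ?_
    filter_upwards [self_mem_nhdsWithin] with s hs
    rw [← norm_fourierMat, norm_sq_L2, fourierMat_sub]
    refine lintegral_congr_ae ?_
    filter_upwards [fourierMat_heatL2 hs S, fourierMat_heatL2 ht S,
      Lp.coeFn_sub (fourierMat (heatL2 s S)) (fourierMat (heatL2 t S))] with ξ a b c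
    rw [c, Pi.sub_apply, a, b, ← sub_smul, enorm_smul, mul_pow, ← Complex.ofReal_sub]
    congr 2
    rw [← ofReal_norm, ← ofReal_norm, Complex.norm_real]
  have h2 := (ENNReal.tendsto_toReal ENNReal.zero_ne_top).comp h
  have h3 := (Real.continuous_sqrt.tendsto _).comp h2
  simpa [Function.comp_def, ENNReal.toReal_ofReal, sq_nonneg, Real.sqrt_sq] using h3

/-! ### The Duhamel kernel -/

/-- The map `x ↦ P_st e^{τΔ} x²`. -/
noncomputable def duhamelKernel (τ : ℝ) (x : L2Mat) : L2Mat := Pst (heatL1 τ (sqL1 x))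

theorem norm_duhamelKernel_sub_le {τ : ℝ} (hτ : 0 < τ) (x y : L2Mat) :
    ‖duhamelKernel τ x - duhamelKernel τ y‖ ≤
      gaussNorm * τ ^ (-(3 / 4) : ℝ) * ((‖x‖ + ‖y‖) * ‖x - y‖) := by
  rw [duhamelKernel, duhamelKernel, ← map_sub, ← heatL1_sub hτ]
  refine (norm_Pst_le _).trans ((norm_heatL1_le hτ _).trans ?_)
  have := gaussNorm_pos
  gcongr
  exact norm_sqL1_sub_le x y

theorem norm_duhamelKernel_le {τ : ℝ} (hτ : 0 < τ) (x : L2Mat) :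
    ‖duhamelKernel τ x‖ ≤ gaussNorm * τ ^ (-(3 / 4) : ℝ) * ‖x‖ ^ 2 := by
  refine (norm_Pst_le _).trans ((norm_heatL1_le hτ _).trans ?_)
  have := gaussNorm_pos
  gcongr
  exact norm_sqL1_le x

/-- The semigroup law combined with the commutation of `P_st` and the heat flow. -/
theorem duhamelKernel_add_time {s τ : ℝ} (hs : 0 ≤ s) (hτ : 0 < τ) (x : L2Mat) :
    duhamelKernel (s + τ) x = heatL2 s (duhamelKernel τ x) := by
  rw [duhamelKernel, duhamelKernel, heatL1_add_time hs hτ, heatL2_eq_fourierMul hs,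
    heatL2_eq_fourierMul hs, Pst_fourierMul _ (heatSymbol_neg s)]

/-! ### Continuity and integrability of Duhamel's integrand -/

theorem continuousOn_heatL2 :
    ContinuousOn (fun p : ℝ × L2Mat => heatL2 p.1 p.2) (Set.Ici 0 ×ˢ Set.univ) := by
  rintro ⟨t, x⟩ ⟨ht, -⟩
  rw [ContinuousWithinAt, tendsto_iff_norm_sub_tendsto_zero]
  have h1 : Tendsto (fun p : ℝ × L2Mat => ‖p.2 - x‖ + ‖heatL2 p.1 x - heatL2 t x‖)
      (𝓝[Set.Ici 0 ×ˢ Set.univ] (t, x)) (𝓝 (‖x - x‖ + ‖heatL2 t x - heatL2 t x‖)) := by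
    refine Tendsto.add ?_ ?_
    · exact ((continuous_snd.sub continuous_const).norm.tendsto (t, x)).mono_left
        nhdsWithin_le_nhds
    · refine Tendsto.norm (Tendsto.sub_const ?_ _)
      refine (continuousOn_heatL2_left x t ht).tendsto.comp ?_
      exact tendsto_nhdsWithin_iff.2 ⟨(continuous_fst.tendsto (t, x)).mono_left nhdsWithin_le_nhds,
        by filter_upwards [self_mem_nhdsWithin] with p hp using hp.1⟩
  simp only [sub_self, norm_zero, add_zero] at h1
  refine squeeze_zero' (Eventually.of_forall fun _ => norm_nonneg _) ?_ h1
  filter_upwards [self_mem_nhdsWithin] with p hp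
  calc ‖heatL2 p.1 p.2 - heatL2 t x‖
      ≤ ‖heatL2 p.1 p.2 - heatL2 p.1 x‖ + ‖heatL2 p.1 x - heatL2 t x‖ :=
        norm_sub_le_norm_sub_add_norm_sub _ _ _
    _ ≤ _ := by
        gcongr
        rw [← heatL2_sub hp.1]
        exact norm_heatL2_le hp.1 _

theorem continuous_duhamelKernel_right {τ : ℝ} (hτ : 0 < τ) : Continuous (duhamelKernel τ) := by
  refine continuous_iff_continuousAt.2 fun y => ?_
  rw [ContinuousAt, tendsto_iff_norm_sub_tendsto_zero]
  refine squeeze_zero (fun _ => norm_nonneg _) (fun x => norm_duhamelKernel_sub_le hτ x y) ?_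
  have : Continuous fun x : L2Mat =>
      gaussNorm * τ ^ (-(3 / 4) : ℝ) * ((‖x‖ + ‖y‖) * ‖x - y‖) := by fun_prop
  simpa using this.tendsto y

/-- Near `τ > 0` the flow over time `τ/2` is split off. It already maps into `L²` continuously, and
the remaining flow is the jointly continuous semigroup on `L²`. -/
theorem continuousOn_duhamelKernel :
    ContinuousOn (fun p : ℝ × L2Mat => duhamelKernel p.1 p.2) (Set.Ioi 0 ×ˢ Set.univ) := by
  rintro ⟨τ, x⟩ ⟨hτ, -⟩
  replace hτ : 0 < τ := hτ
  have h : ContinuousOn (fun p : ℝ × L2Mat => heatL2 (p.1 - τ / 2) (duhamelKernel (τ / 2) p.2))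
      (Set.Ioi (τ / 2) ×ˢ Set.univ) := by
    have hf : Continuous fun p : ℝ × L2Mat => (p.1 - τ / 2, duhamelKernel (τ / 2) p.2) :=
      (continuous_fst.sub continuous_const).prodMk
        ((continuous_duhamelKernel_right (half_pos hτ)).comp continuous_snd)
    exact continuousOn_heatL2.comp hf.continuousOn fun p hp =>
      ⟨Set.mem_Ici.2 (sub_nonneg.2 (Set.mem_Ioi.1 hp.1).le), Set.mem_univ _⟩
  have ho : Set.Ioi (τ / 2) ×ˢ (Set.univ : Set L2Mat) ∈ 𝓝 (τ, x) :=
    (isOpen_Ioi.prod isOpen_univ).mem_nhds ⟨half_lt_self hτ, Set.mem_univ _⟩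
  refine ((h.continuousAt ho).congr ?_).continuousWithinAt
  filter_upwards [ho] with p hp
  rw [← duhamelKernel_add_time (sub_nonneg.2 (le_of_lt hp.1)) (half_pos hτ), sub_add_cancel]

theorem continuousOn_duhamelKernel_comp {S : ℝ → L2Mat} {t : ℝ}
    (hS : ContinuousOn S (Set.Icc 0 t)) :
    ContinuousOn (fun τ => duhamelKernel τ (S (t - τ))) (Set.Ioc 0 t) := by
  have h1 : ContinuousOn (fun τ => S (t - τ)) (Set.Ioc 0 t) := hS.comp (by fun_prop)
    fun τ hτ => ⟨sub_nonneg.2 hτ.2, sub_le_self _ hτ.1.le⟩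
  have h2 : ContinuousOn (fun τ => (τ, S (t - τ))) (Set.Ioc 0 t) := continuousOn_id.prodMk h1
  have h3 : Set.MapsTo (fun τ => (τ, S (t - τ))) (Set.Ioc 0 t) (Set.Ioi 0 ×ˢ Set.univ) :=
    fun τ hτ => Set.mk_mem_prod hτ.1 (Set.mem_univ _)
  have h4 := continuousOn_duhamelKernel.comp h2 h3
  simpa only [Function.comp_def] using h4

theorem intervalIntegrable_duhamelKernel {S : ℝ → L2Mat} {t : ℝ} (ht : 0 ≤ t)
    (hS : ContinuousOn S (Set.Icc 0 t)) :
    IntervalIntegrable (fun τ => duhamelKernel τ (S (t - τ))) volume 0 t := by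
  obtain ⟨M, hM⟩ := isCompact_Icc.exists_bound_of_continuousOn hS
  have hb : IntervalIntegrable (fun τ : ℝ => gaussNorm * τ ^ (-(3 / 4) : ℝ) * M ^ 2) volume 0 t :=
    ((intervalIntegral.intervalIntegrable_rpow' (by norm_num)).const_mul _).mul_const _
  rw [intervalIntegrable_iff_integrableOn_Ioc_of_le ht] at hb ⊢
  refine Integrable.mono' hb
    ((continuousOn_duhamelKernel_comp hS).aestronglyMeasurable measurableSet_Ioc) ?_
  refine (ae_restrict_mem measurableSet_Ioc).mono fun τ hτ => ?_
  refine (norm_duhamelKernel_le hτ.1 _).trans ?_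
  have := gaussNorm_pos
  have h0 : 0 ≤ τ := hτ.1.le
  have := hM (t - τ) ⟨sub_nonneg.2 hτ.2, sub_le_self _ h0⟩
  gcongr

/-- The integrand is extended by zero so that the domain no longer depends on `t`; dominated
convergence applies with majorant `‖g‖ τ^{-3/4} M²`. -/
theorem continuousOn_integral_duhamelKernel {S : ℝ → L2Mat} (hS : Continuous S) (T : ℝ) :
    ContinuousOn (fun t => ∫ τ in (0 : ℝ)..t, duhamelKernel τ (S (t - τ))) (Set.Icc 0 T) := by
  obtain ⟨M, hM⟩ := (isCompact_Icc (a := (0 : ℝ)) (b := T)).exists_bound_of_continuousOn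
    hS.continuousOn
  have hg := gaussNorm_pos
  intro t₀ ht₀
  have hT : 0 ≤ T := ht₀.1.trans ht₀.2
  have key : ContinuousWithinAt (fun t => ∫ τ, (Set.Ioc 0 t).indicator
      (fun τ => duhamelKernel τ (S (t - τ))) τ) (Set.Icc 0 T) t₀ := by
    refine continuousWithinAt_of_dominated
      (bound := (Set.Ioc 0 T).indicator fun τ => gaussNorm * τ ^ (-(3 / 4) : ℝ) * M ^ 2) ?_ ?_ ?_ ?_
    · refine Eventually.of_forall fun t => ?_
      exact (aestronglyMeasurable_indicator_iff measurableSet_Ioc).2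
        ((continuousOn_duhamelKernel_comp hS.continuousOn).aestronglyMeasurable measurableSet_Ioc)
    · filter_upwards [self_mem_nhdsWithin] with t ht
      refine Eventually.of_forall fun τ => ?_
      by_cases hτ : τ ∈ Set.Ioc 0 t
      · rw [Set.indicator_of_mem hτ, Set.indicator_of_mem (show τ ∈ Set.Ioc 0 T from ⟨hτ.1, hτ.2.trans ht.2⟩)]
        refine (norm_duhamelKernel_le hτ.1 _).trans ?_
        have h0 : 0 ≤ τ := hτ.1.le
        have := hM (t - τ) ⟨sub_nonneg.2 hτ.2, (sub_le_self _ h0).trans ht.2⟩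
        gcongr
      · rw [Set.indicator_of_notMem hτ, norm_zero]
        refine Set.indicator_nonneg (fun τ hτ => ?_) τ
        have h0 : 0 ≤ τ := hτ.1.le
        positivity
    · rw [integrable_indicator_iff measurableSet_Ioc,
        ← intervalIntegrable_iff_integrableOn_Ioc_of_le hT]
      exact ((intervalIntegral.intervalIntegrable_rpow' (by norm_num)).const_mul _).mul_const _
    -- For `τ ≠ t₀` the indicator of `(0, t]` at `τ` is constant for `t` near `t₀`; the exceptional
    -- point is a null set.
    · have hne : ∀ᵐ τ : ℝ, τ ≠ t₀ := by simp [ae_iff]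
      filter_upwards [hne] with τ hτ
      refine ContinuousAt.continuousWithinAt ?_
      rcases lt_or_gt_of_ne hτ with h | h
      · rcases le_or_gt τ 0 with h0 | h0
        · refine (continuousAt_const (y := (0 : L2Mat))).congr (Eventually.of_forall fun t => ?_)
          exact (Set.indicator_of_notMem (fun hm => hm.1.not_ge h0) _).symm
        · have hc : Continuous fun t => duhamelKernel τ (S (t - τ)) :=
            (continuous_duhamelKernel_right h0).comp (hS.comp (by fun_prop))
          refine hc.continuousAt.congr ?_
          filter_upwards [lt_mem_nhds h] with t ht
          exact (Set.indicator_of_mem (show τ ∈ Set.Ioc 0 t from ⟨h0, le_of_lt ht⟩)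
            fun τ => duhamelKernel τ (S (t - τ))).symm
      · refine (continuousAt_const (y := (0 : L2Mat))).congr ?_
        filter_upwards [gt_mem_nhds h] with t ht
        exact (Set.indicator_of_notMem (fun hm => hm.2.not_gt ht) _).symm
  refine key.congr (fun t ht => ?_) ?_
  · rw [intervalIntegral.integral_of_le ht.1, integral_indicator measurableSet_Ioc]
  · rw [intervalIntegral.integral_of_le ht₀.1, integral_indicator measurableSet_Ioc]

theorem integral_rpow_neg_three_quarters (t : ℝ) :
    ∫ τ in (0 : ℝ)..t, τ ^ (-(3 / 4) : ℝ) = 4 * t ^ (1 / 4 : ℝ) := by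
  rw [integral_rpow (Or.inl (by norm_num))]
  norm_num
  ring

/-- `‖∫₀ᵗ f‖ ≤ 4 c t^{1/4}` if `‖f τ‖ ≤ c τ^{-3/4}`. -/
theorem norm_integral_le_of_norm_le_rpow {F : Type*} [NormedAddCommGroup F] [NormedSpace ℝ F]
    {f : ℝ → F} {t c : ℝ} (ht : 0 ≤ t)
    (h : ∀ τ ∈ Set.Ioc 0 t, ‖f τ‖ ≤ c * τ ^ (-(3 / 4) : ℝ)) :
    ‖∫ τ in (0 : ℝ)..t, f τ‖ ≤ c * (4 * t ^ (1 / 4 : ℝ)) := by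
  rw [← integral_rpow_neg_three_quarters, ← intervalIntegral.integral_const_mul]
  exact intervalIntegral.norm_integral_le_of_norm_le ht (Eventually.of_forall h)
    ((intervalIntegral.intervalIntegrable_rpow' (by norm_num)).const_mul _)

/-! ### Gronwall's inequality with a singular kernel -/

/-- Since `∫₀^∞ τ^{-3/4} e^{-rτ} dτ = Γ(1/4) r^{-1/4}`, a large rate `r` makes the singular kernel
small against the weight `e^{rt}`, uniformly in the length of the time interval. -/
theorem exists_rate (c : ℝ) (hc : 0 ≤ c) : ∃ r : ℝ, 0 < r ∧ ∀ {F : Type} [NormedAddCommGroup F]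
    [NormedSpace ℝ F] {f : ℝ → F} {t E : ℝ}, 0 ≤ t → 0 ≤ E →
    (∀ τ ∈ Set.Ioc 0 t, ‖f τ‖ ≤ c * τ ^ (-(3 / 4) : ℝ) * (E * Real.exp (r * (t - τ)))) →
    ‖∫ τ in (0 : ℝ)..t, f τ‖ ≤ E / 2 * Real.exp (r * t) := by
  have hΓ : 0 < Real.Gamma (1 / 4) := Real.Gamma_pos_of_pos (by norm_num)
  -- The rate is `b⁴`, so that `r^{-1/4} = 1/b` and `c Γ(1/4)/b ≤ 1/2`; the summand 1 keeps `b`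
  -- positive when `c = 0`.
  set b := 2 * c * Real.Gamma (1 / 4) + 1 with hb
  have hb0 : 0 < b := by positivity
  refine ⟨b ^ 4, by positivity, fun {F} _ _ {f t E} ht hE h => ?_⟩
  have hi : IntegrableOn (fun τ : ℝ => τ ^ (-(3 / 4) : ℝ) * Real.exp (-(b ^ 4 * τ)))
      (Set.Ioi 0) := by
    have := integrableOn_rpow_mul_exp_neg_mul_rpow (p := 1) (s := (-(3 / 4) : ℝ)) (b := b ^ 4)
      (by norm_num) one_pos (by positivity)
    simpa using this
  have hI : ∫ τ in (0 : ℝ)..t, τ ^ (-(3 / 4) : ℝ) * Real.exp (-(b ^ 4 * τ)) ≤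
      Real.Gamma (1 / 4) / b := by
    have h2 := Real.integral_rpow_mul_exp_neg_mul_Ioi (a := 1 / 4) (r := b ^ 4) (by norm_num)
      (by positivity)
    have h3 : (1 / b ^ 4) ^ (1 / 4 : ℝ) = 1 / b := by
      rw [← one_div_pow, ← Real.rpow_natCast (1 / b), ← Real.rpow_mul (by positivity)]
      norm_num
    rw [h3] at h2
    norm_num at h2
    rw [intervalIntegral.integral_of_le ht,
      show Real.Gamma (1 / 4) / b = b⁻¹ * Real.Gamma (1 / 4) from div_eq_inv_mul _ _, ← h2]
    refine setIntegral_mono_set hi ?_ (Set.Ioc_subset_Ioi_self.eventuallyLE)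
    refine (ae_restrict_mem measurableSet_Ioi).mono fun τ hτ => ?_
    have : (0 : ℝ) < τ := hτ
    simp only [Pi.zero_apply]
    positivity
  have e : ∀ τ : ℝ, c * τ ^ (-(3 / 4) : ℝ) * (E * Real.exp (b ^ 4 * (t - τ))) =
      c * E * Real.exp (b ^ 4 * t) * (τ ^ (-(3 / 4) : ℝ) * Real.exp (-(b ^ 4 * τ))) := by
    intro τ
    rw [mul_sub, sub_eq_add_neg, Real.exp_add]
    ring
  simp only [e] at h
  have h1 := intervalIntegral.norm_integral_le_of_norm_le ht (Eventually.of_forall h)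
    (((intervalIntegrable_iff_integrableOn_Ioc_of_le ht).2
      (hi.mono_set Set.Ioc_subset_Ioi_self)).const_mul _)
  rw [intervalIntegral.integral_const_mul] at h1
  refine h1.trans ((mul_le_mul_of_nonneg_left hI (by positivity)).trans ?_)
  have h4 : c * (Real.Gamma (1 / 4) / b) ≤ 1 / 2 := by
    rw [← mul_div_assoc, div_le_iff₀ hb0, hb]
    linarith
  calc _ = E * Real.exp (b ^ 4 * t) * (c * (Real.Gamma (1 / 4) / b)) := by ring
    _ ≤ E * Real.exp (b ^ 4 * t) * (1 / 2) := by gcongr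
    _ = _ := by ring

/-- Because `e^{rt} ≥ 1`, the hypothesis improves the constant `E` to `A + E/2`. Starting from `2A +
Y` the iterates are `2A + Y/2ⁿ`, so the a priori bound `Y` disappears. No measurability or
continuity of `y` is required. -/
theorem le_of_forall_improve {s : Set ℝ} {y : ℝ → ℝ} {A Y r : ℝ} (hs : ∀ t ∈ s, 0 ≤ t)
    (hA : 0 ≤ A) (hr : 0 ≤ r) (hY : 0 ≤ Y) (hy : ∀ t ∈ s, y t ≤ Y)
    (h : ∀ E, 0 ≤ E → (∀ t ∈ s, y t ≤ E * Real.exp (r * t)) →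
      ∀ t ∈ s, y t ≤ A + E / 2 * Real.exp (r * t)) :
    ∀ t ∈ s, y t ≤ 2 * A * Real.exp (r * t) := by
  have hexp : ∀ t ∈ s, 1 ≤ Real.exp (r * t) := fun t ht =>
    Real.one_le_exp (mul_nonneg hr (hs t ht))
  have hn : ∀ n : ℕ, ∀ t ∈ s, y t ≤ (2 * A + Y / 2 ^ n) * Real.exp (r * t) := by
    intro n
    induction n with
    | zero =>
      intro t ht
      refine (hy t ht).trans ?_
      have := hexp t ht
      simp only [pow_zero, div_one]
      nlinarith
    | succ n ih =>
      intro t ht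
      refine (h _ (by positivity) ih t ht).trans ?_
      have := hexp t ht
      rw [pow_succ, ← div_div]
      nlinarith
  intro t ht
  have hlim : Tendsto (fun n : ℕ => (2 * A + Y / 2 ^ n) * Real.exp (r * t)) atTop
      (𝓝 ((2 * A + 0) * Real.exp (r * t))) := by
    refine Tendsto.mul_const _ (Tendsto.const_add _ ?_)
    exact tendsto_const_nhds.div_atTop (tendsto_pow_atTop_atTop_of_one_lt one_lt_two)
  rw [add_zero] at hlim
  exact ge_of_tendsto' hlim fun n => hn n t ht

/-! ### Local existence -/

/-- The right-hand side of Duhamel's formula. -/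
noncomputable def duhamelMap (S0 : L2Mat) (S : ℝ → L2Mat) (t : ℝ) : L2Mat :=
  heatL2 t S0 - (2 / 3 : ℝ) • ∫ τ in (0 : ℝ)..t, duhamelKernel τ (S (t - τ))

theorem norm_duhamelMap_le (S0 : L2Mat) {S : ℝ → L2Mat} {T M : ℝ}
    (hM : ∀ t ∈ Set.Icc 0 T, ‖S t‖ ≤ M) {t : ℝ} (ht : t ∈ Set.Icc 0 T) :
    ‖duhamelMap S0 S t‖ ≤ ‖S0‖ + 8 / 3 * gaussNorm * T ^ (1 / 4 : ℝ) * M ^ 2 := by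
  have hg := gaussNorm_pos
  have h : ‖∫ τ in (0 : ℝ)..t, duhamelKernel τ (S (t - τ))‖ ≤
      (gaussNorm * M ^ 2) * (4 * t ^ (1 / 4 : ℝ)) := by
    refine norm_integral_le_of_norm_le_rpow ht.1 fun τ hτ => ?_
    refine (norm_duhamelKernel_le hτ.1 _).trans ?_
    have h0 : 0 ≤ τ := hτ.1.le
    have := hM (t - τ) ⟨sub_nonneg.2 hτ.2, (sub_le_self _ h0).trans ht.2⟩
    calc _ ≤ gaussNorm * τ ^ (-(3 / 4) : ℝ) * M ^ 2 := by gcongr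
      _ = _ := by ring
  have hT : t ^ (1 / 4 : ℝ) ≤ T ^ (1 / 4 : ℝ) := Real.rpow_le_rpow ht.1 ht.2 (by norm_num)
  refine (norm_sub_le _ _).trans (add_le_add (norm_heatL2_le ht.1 _) ?_)
  rw [norm_smul, Real.norm_of_nonneg (by norm_num)]
  calc _ ≤ 2 / 3 * ((gaussNorm * M ^ 2) * (4 * T ^ (1 / 4 : ℝ))) := by gcongr; exact h.trans (by gcongr)
    _ = _ := by ring

theorem norm_duhamelMap_sub_le (S0 : L2Mat) {R S : ℝ → L2Mat} {T M D : ℝ}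
    (hRc : ContinuousOn R (Set.Icc 0 T)) (hSc : ContinuousOn S (Set.Icc 0 T))
    (hR : ∀ t ∈ Set.Icc 0 T, ‖R t‖ ≤ M) (hS : ∀ t ∈ Set.Icc 0 T, ‖S t‖ ≤ M)
    (hD : ∀ t ∈ Set.Icc 0 T, ‖R t - S t‖ ≤ D) {t : ℝ} (ht : t ∈ Set.Icc 0 T) :
    ‖duhamelMap S0 R t - duhamelMap S0 S t‖ ≤
      16 / 3 * gaussNorm * T ^ (1 / 4 : ℝ) * M * D := by
  have hg := gaussNorm_pos
  have hM : 0 ≤ M := (norm_nonneg _).trans (hR t ht)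
  have hD0 : 0 ≤ D := (norm_nonneg _).trans (hD t ht)
  have hsub : Set.Icc 0 t ⊆ Set.Icc 0 T := Set.Icc_subset_Icc_right ht.2
  have h : ‖∫ τ in (0 : ℝ)..t, (duhamelKernel τ (R (t - τ)) - duhamelKernel τ (S (t - τ)))‖ ≤
      (gaussNorm * (2 * M * D)) * (4 * t ^ (1 / 4 : ℝ)) := by
    refine norm_integral_le_of_norm_le_rpow ht.1 fun τ hτ => ?_
    refine (norm_duhamelKernel_sub_le hτ.1 _ _).trans ?_
    have h0 : 0 ≤ τ := hτ.1.le
    have hm : t - τ ∈ Set.Icc 0 T := ⟨sub_nonneg.2 hτ.2, (sub_le_self _ h0).trans ht.2⟩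
    have h1 := hR _ hm
    have h2 := hS _ hm
    have h3 := hD _ hm
    calc _ ≤ gaussNorm * τ ^ (-(3 / 4) : ℝ) * ((M + M) * D) := by gcongr
      _ = _ := by ring
  rw [intervalIntegral.integral_sub (intervalIntegrable_duhamelKernel ht.1 (hRc.mono hsub))
    (intervalIntegrable_duhamelKernel ht.1 (hSc.mono hsub))] at h
  have hT : t ^ (1 / 4 : ℝ) ≤ T ^ (1 / 4 : ℝ) := Real.rpow_le_rpow ht.1 ht.2 (by norm_num)
  rw [duhamelMap, duhamelMap, sub_sub_sub_cancel_left, ← smul_sub, norm_smul, norm_sub_rev,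
    Real.norm_of_nonneg (by norm_num)]
  calc _ ≤ 2 / 3 * ((gaussNorm * (2 * M * D)) * (4 * T ^ (1 / 4 : ℝ))) := by
        gcongr; exact h.trans (by gcongr)
    _ = _ := by ring

theorem continuousOn_duhamelMap (S0 : L2Mat) {S : ℝ → L2Mat} (hS : Continuous S) (T : ℝ) :
    ContinuousOn (duhamelMap S0 S) (Set.Icc 0 T) :=
  ((continuousOn_heatL2_left S0).mono Set.Icc_subset_Ici_self).sub
    ((continuousOn_integral_duhamelKernel hS T).fun_const_smul (2 / 3 : ℝ))

/-- Banach's fixed point theorem on the ball of radius `2‖S0‖`. The Lipschitz constant there is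
`(16/3)‖g‖T^{1/4} · 2‖S0‖`. The ball is mapped to itself because `(8/3)‖g‖T^{1/4} (2‖S0‖)²` is the
same number times `‖S0‖`. Constant extension beyond `[0, T]` makes the solution continuous on `ℝ`.
-/
theorem exists_duhamelMap_fixed (S0 : L2Mat) {T : ℝ} (hT : 0 ≤ T)
    (h : 32 / 3 * gaussNorm * T ^ (1 / 4 : ℝ) * ‖S0‖ < 1) :
    ∃ S : ℝ → L2Mat, Continuous S ∧ ∀ t ∈ Set.Icc 0 T, S t = duhamelMap S0 S t := by
  have hg := gaussNorm_pos
  have hT4 : 0 ≤ T ^ (1 / 4 : ℝ) := Real.rpow_nonneg hT _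
  let ext (u : C(Set.Icc (0 : ℝ) T, L2Mat)) : ℝ → L2Mat := Set.IccExtend hT u
  have hext : ∀ u, Continuous (ext u) := fun u => u.continuous.Icc_extend'
  have hextn : ∀ u t, ‖ext u t‖ ≤ ‖u‖ := fun u t => u.norm_coe_le_norm _
  let Φ (u : C(Set.Icc (0 : ℝ) T, L2Mat)) : C(Set.Icc (0 : ℝ) T, L2Mat) :=
    ⟨fun t => duhamelMap S0 (ext u) t,
      continuousOn_iff_continuous_domRestrict.1 (continuousOn_duhamelMap S0 (hext u) T)⟩
  let B : Set C(Set.Icc (0 : ℝ) T, L2Mat) := Metric.closedBall 0 (2 * ‖S0‖)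
  have hmaps : Set.MapsTo Φ B B := by
    intro u hu
    rw [mem_closedBall_zero_iff] at hu ⊢
    refine (ContinuousMap.norm_le _ (by positivity)).2 fun t => ?_
    refine (norm_duhamelMap_le S0 (fun s _ => (hextn u s).trans hu) t.2).trans ?_
    nlinarith [norm_nonneg S0]
  let k : NNReal := ⟨32 / 3 * gaussNorm * T ^ (1 / 4 : ℝ) * ‖S0‖, by positivity⟩
  have hlip : ContractingWith k (hmaps.restrict Φ B B) := by
    refine ⟨by exact_mod_cast h, LipschitzWith.of_dist_le_mul fun u v => ?_⟩
    have hu := mem_closedBall_zero_iff.1 u.2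
    have hv := mem_closedBall_zero_iff.1 v.2
    rw [Subtype.dist_eq, Subtype.dist_eq, dist_eq_norm, dist_eq_norm]
    refine (ContinuousMap.norm_le _ (by positivity)).2 fun t => ?_
    refine (norm_duhamelMap_sub_le S0 (M := 2 * ‖S0‖) (D := ‖u.1 - v.1‖) (hext u.1).continuousOn
      (hext v.1).continuousOn (fun s _ => (hextn _ s).trans hu) (fun s _ => (hextn _ s).trans hv)
      (fun s _ => (u.1 - v.1).norm_coe_le_norm _) t.2).trans (le_of_eq ?_)
    change _ = 32 / 3 * gaussNorm * T ^ (1 / 4 : ℝ) * ‖S0‖ * _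
    ring
  obtain ⟨u, -, hu, -⟩ := hlip.exists_fixedPoint' (s := B) Metric.isClosed_closedBall.isComplete
    hmaps (x := 0) (Metric.mem_closedBall_self (by positivity)) (edist_ne_top _ _)
  refine ⟨ext u, hext u, fun t ht => ?_⟩
  have h1 := congrArg (fun w : C(Set.Icc (0 : ℝ) T, L2Mat) => w ⟨t, ht⟩) hu
  exact (Set.IccExtend_of_mem hT u ht).trans h1.symm

/-- `P_st` commutes with the Bochner integral and fixes its integrand, so it fixes the integral. -/
theorem duhamelMap_mem {S0 : L2Mat} (hS0 : S0 ∈ L2st) {S : ℝ → L2Mat} {t : ℝ} (ht : 0 ≤ t)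
    (hS : ContinuousOn S (Set.Icc 0 t)) : duhamelMap S0 S t ∈ L2st := by
  have hi := intervalIntegrable_duhamelKernel ht hS
  have h : ∫ τ in (0 : ℝ)..t, duhamelKernel τ (S (t - τ)) ∈ L2st := by
    have e : ∫ τ in (0 : ℝ)..t, duhamelKernel τ (S (t - τ)) =
        Pst (∫ τ in (0 : ℝ)..t, duhamelKernel τ (S (t - τ))) := by
      rw [← Pst.intervalIntegral_comp_comm hi]
      refine intervalIntegral.integral_congr fun τ _ => ?_
      exact (Submodule.starProjection_eq_self_iff.2
        (L2st.le_topologicalClosure (Pst_mem _))).symm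
    rw [e]
    exact Pst_mem _
  exact L2st.sub_mem (heatL2_mem ht hS0) (L2st.smul_mem _ h)

theorem exists_isMildSolution {S0 : L2Mat} (hS0 : S0 ∈ L2st) {T : ℝ} (hT : 0 ≤ T)
    (h : 32 / 3 * gaussNorm * T ^ (1 / 4 : ℝ) * ‖S0‖ < 1) :
    ∃ S, IsMildSolution S0 (ENNReal.ofReal T) S := by
  obtain ⟨S, hc, hS⟩ := exists_duhamelMap_fixed S0 hT h
  have hlt : ∀ {t}, ENNReal.ofReal t < ENNReal.ofReal T → t ≤ T := fun ht =>
    (lt_of_not_ge fun h => ht.not_ge (ENNReal.ofReal_le_ofReal h)).le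
  refine ⟨S, fun t h0 ht => ?_, hc.continuousOn, ?_, fun t h0 ht => ?_, fun t h0 ht => ?_⟩
  · rw [hS t ⟨h0, hlt ht⟩]
    exact duhamelMap_mem hS0 h0 hc.continuousOn
  · rw [hS 0 ⟨le_rfl, hT⟩]
    simp [duhamelMap, heatL2]
  · exact intervalIntegrable_duhamelKernel h0.le hc.continuousOn
  · exact hS t ⟨h0.le, hlt ht⟩

theorem existenceConst_eq : existenceConst = ENNReal.ofReal ((3 / (32 * gaussNorm)) ^ 4) := by
  have hg := gaussNorm_pos
  rw [existenceConst, eLpNorm_gaussianProfile, ENNReal.ofReal_pow (by positivity),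
    ENNReal.ofReal_div_of_pos (by positivity), ENNReal.ofReal_mul (by norm_num)]
  simp [gaussNorm]

theorem small_of_lt_existenceConst {S0 : L2Mat} {T : ℝ} (hT : 0 ≤ T)
    (h : ENNReal.ofReal T < existenceConst / ‖S0‖ₑ ^ 4) :
    32 / 3 * gaussNorm * T ^ (1 / 4 : ℝ) * ‖S0‖ < 1 := by
  have hg := gaussNorm_pos
  -- For zero data the quotient is `⊤` and `h` says nothing, but the smallness condition is trivial.
  rcases (norm_nonneg S0).eq_or_lt with h0 | h0
  · rw [← h0]
    simp
  rw [existenceConst_eq, ← ofReal_norm, ← ENNReal.ofReal_pow h0.le,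
    ← ENNReal.ofReal_div_of_pos (by positivity), ← div_pow,
    ENNReal.ofReal_lt_ofReal_iff (by positivity)] at h
  have h1 := Real.rpow_lt_rpow hT h (by norm_num : (0 : ℝ) < 1 / 4)
  rw [← Real.rpow_natCast (_ / _), ← Real.rpow_mul (by positivity)] at h1
  norm_num at h1
  rw [div_div, lt_div_iff₀ (by positivity)] at h1
  norm_num
  linarith

/-! ### Uniqueness and the maximal solution -/

namespace IsMildSolution

variable {S0 : L2Mat} {T : ℝ≥0∞} {S : ℝ → L2Mat}

theorem continuousOn_Icc (h : IsMildSolution S0 T S) {t : ℝ} (ht : ENNReal.ofReal t < T) :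
    ContinuousOn S (Set.Icc 0 t) :=
  h.continuousOn.mono fun _ hs => ⟨hs.1, (ENNReal.ofReal_le_ofReal hs.2).trans_lt ht⟩

theorem eq_duhamelMap (h : IsMildSolution S0 T S) {t : ℝ} (h0 : 0 ≤ t)
    (ht : ENNReal.ofReal t < T) : S t = duhamelMap S0 S t := by
  rcases h0.eq_or_lt with rfl | h0
  · rw [h.initial]
    simp [duhamelMap, heatL2]
  · exact h.duhamel t h0 ht

/-- The norm of the difference satisfies a homogeneous inequality with kernel `‖g‖(M₁ + M₂)
τ^{-3/4}`, so the iteration applies with `A = 0`. The factor `2/3` in Duhamel's formula is simply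
dropped. -/
theorem unique (hS : IsMildSolution S0 T S) {T' : ℝ≥0∞} {R : ℝ → L2Mat}
    (hR : IsMildSolution S0 T' R) {t : ℝ} (h0 : 0 ≤ t) (ht : ENNReal.ofReal t < T)
    (ht' : ENNReal.ofReal t < T') : R t = S t := by
  have hg := gaussNorm_pos
  have hSc := hS.continuousOn_Icc ht
  have hRc := hR.continuousOn_Icc ht'
  obtain ⟨M₁, hM₁⟩ := isCompact_Icc.exists_bound_of_continuousOn hSc
  obtain ⟨M₂, hM₂⟩ := isCompact_Icc.exists_bound_of_continuousOn hRc
  have h00 : (0 : ℝ) ∈ Set.Icc 0 t := ⟨le_rfl, h0⟩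
  have hM : 0 ≤ M₁ + M₂ := add_nonneg ((norm_nonneg _).trans (hM₁ 0 h00))
    ((norm_nonneg _).trans (hM₂ 0 h00))
  obtain ⟨r, hr, hI⟩ := exists_rate (gaussNorm * (M₁ + M₂)) (by positivity)
  have key := le_of_forall_improve (s := Set.Icc 0 t) (y := fun s => ‖R s - S s‖) (A := 0)
    (Y := M₁ + M₂) (r := r) (fun s hs => hs.1) le_rfl hr.le hM
    (fun s hs => (norm_sub_le _ _).trans (by linarith [hM₁ s hs, hM₂ s hs])) ?_
  · have := key t ⟨h0, le_rfl⟩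
    simp only [mul_zero, zero_mul] at this
    exact sub_eq_zero.1 (norm_le_zero_iff.1 this)
  intro E hE hyp s hs
  have hsub : Set.Icc 0 s ⊆ Set.Icc 0 t := Set.Icc_subset_Icc_right hs.2
  have hle := ENNReal.ofReal_le_ofReal hs.2
  have h1 := hI (f := fun τ => duhamelKernel τ (R (s - τ)) - duhamelKernel τ (S (s - τ)))
    hs.1 hE fun τ hτ => by
      have h0τ : 0 ≤ τ := hτ.1.le
      have hm : s - τ ∈ Set.Icc 0 t := ⟨sub_nonneg.2 hτ.2, (sub_le_self _ h0τ).trans hs.2⟩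
      refine (norm_duhamelKernel_sub_le hτ.1 _ _).trans ?_
      have h1 := hM₁ _ hm
      have h2 := hM₂ _ hm
      have h3 := hyp _ hm
      calc _ ≤ gaussNorm * τ ^ (-(3 / 4) : ℝ) * ((M₂ + M₁) * (E * Real.exp (r * (s - τ)))) := by
            rw [add_comm] at hM
            gcongr
        _ = _ := by ring
  rw [intervalIntegral.integral_sub (intervalIntegrable_duhamelKernel hs.1 (hRc.mono hsub))
    (intervalIntegrable_duhamelKernel hs.1 (hSc.mono hsub))] at h1
  rw [hS.eq_duhamelMap hs.1 (hle.trans_lt ht), hR.eq_duhamelMap hs.1 (hle.trans_lt ht'),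
    duhamelMap, duhamelMap, sub_sub_sub_cancel_left, ← smul_sub, norm_smul, norm_sub_rev,
    Real.norm_of_nonneg (by norm_num)]
  linarith [norm_nonneg ((∫ τ in (0 : ℝ)..s, duhamelKernel τ (R (s - τ))) -
    ∫ τ in (0 : ℝ)..s, duhamelKernel τ (S (s - τ)))]

theorem congr (hS : IsMildSolution S0 T S) {R : ℝ → L2Mat} (h0 : R 0 = S0)
    (h : ∀ t, 0 ≤ t → ENNReal.ofReal t < T → R t = S t) : IsMildSolution S0 T R where
  mem t h0 ht := by
    rw [h t h0 ht]
    exact hS.mem t h0 ht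
  continuousOn := hS.continuousOn.congr fun t ht => h t ht.1 ht.2
  initial := h0
  integrable t h0 ht := by
    refine (hS.integrable t h0 ht).congr fun τ hτ => ?_
    rw [Set.uIoc_of_le h0.le] at hτ
    simp only [duhamelIntegrand]
    rw [h (t - τ) (sub_nonneg.2 hτ.2)
      ((ENNReal.ofReal_le_ofReal (sub_le_self _ hτ.1.le)).trans_lt ht)]
  duhamel t h0 ht := by
    rw [h t h0.le ht, hS.duhamel t h0 ht]
    congr 2
    refine intervalIntegral.integral_congr fun τ hτ => ?_
    rw [Set.uIcc_of_le h0.le] at hτ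
    simp only [duhamelIntegrand]
    rw [h (t - τ) (sub_nonneg.2 hτ.2)
      ((ENNReal.ofReal_le_ofReal (sub_le_self _ hτ.1)).trans_lt ht)]

/-- Mild solutions on all `[0, T')` with `T' < T` are a mild solution on `[0, T)`. -/
theorem of_forall_exists (h0 : S 0 = S0) (h : ∀ t, 0 ≤ t → ENNReal.ofReal t < T →
    ∃ T', ENNReal.ofReal t < T' ∧ IsMildSolution S0 T' S) : IsMildSolution S0 T S where
  mem t h0 ht := by
    obtain ⟨T', h1, h2⟩ := h t h0 ht
    exact h2.mem t h0 h1
  continuousOn t ht := by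
    obtain ⟨T', h1, h2⟩ := h t ht.1 ht.2
    refine (h2.continuousOn t ⟨ht.1, h1⟩).mono_of_mem_nhdsWithin ?_
    have ho : IsOpen {s : ℝ | ENNReal.ofReal s < T'} :=
      isOpen_lt ENNReal.continuous_ofReal continuous_const
    filter_upwards [self_mem_nhdsWithin, mem_nhdsWithin_of_mem_nhds (ho.mem_nhds h1)] with s hs hs'
    exact ⟨hs.1, hs'⟩
  initial := h0
  integrable t h0 ht := by
    obtain ⟨T', h1, h2⟩ := h t h0.le ht
    exact h2.integrable t h0 h1
  duhamel t h0 ht := by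
    obtain ⟨T', h1, h2⟩ := h t h0.le ht
    exact h2.duhamel t h0 h1

end IsMildSolution

/-- `Tmax` is the supremum of all existence times, so maximality is automatic; uniqueness makes the
solutions patch together. -/
theorem exists_maximal_isMildSolution {S0 : L2Mat} (hS0 : S0 ∈ L2st) :
    ∃ (Tmax : ℝ≥0∞) (S : ℝ → L2Mat), existenceConst / ‖S0‖ₑ ^ 4 ≤ Tmax ∧
      IsMildSolution S0 Tmax S ∧
      ∀ (T : ℝ≥0∞) (R : ℝ → L2Mat), IsMildSolution S0 T R →
        T ≤ Tmax ∧ ∀ t : ℝ, 0 ≤ t → ENNReal.ofReal t < T → R t = S t := by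
  classical
  let A : Set ℝ≥0∞ := {T | ∃ R, IsMildSolution S0 T R}
  -- At time `t` any solution that lives beyond `t` is used. The default `S0` secures the initial
  -- condition in case none lives beyond time 0.
  let S : ℝ → L2Mat := fun t =>
    if h : ∃ T R, IsMildSolution S0 T R ∧ ENNReal.ofReal t < T then h.choose_spec.choose t else S0
  have huniq : ∀ (T : ℝ≥0∞) (R : ℝ → L2Mat), IsMildSolution S0 T R →
      ∀ t : ℝ, 0 ≤ t → ENNReal.ofReal t < T → R t = S t := by
    intro T R hR t h0 ht
    have h : ∃ T R, IsMildSolution S0 T R ∧ ENNReal.ofReal t < T := ⟨T, R, hR, ht⟩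
    have hs := h.choose_spec.choose_spec
    have e : S t = h.choose_spec.choose t := dif_pos h
    rw [e]
    exact hs.1.unique hR h0 hs.2 ht
  have hinit : S 0 = S0 := by
    by_cases h : ∃ T R, IsMildSolution S0 T R ∧ ENNReal.ofReal 0 < T
    · obtain ⟨T, R, hR, hT⟩ := h
      rw [← huniq T R hR 0 le_rfl hT, hR.initial]
    · exact dif_neg h
  refine ⟨sSup A, S, ?_, ?_, fun T R hR => ⟨le_sSup ⟨R, hR⟩, huniq T R hR⟩⟩
  -- The contraction needs strict inequality, so the lower bound is reached only as a supremum of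
  -- shorter existence times `d`.
  · refine le_of_forall_lt fun c hc => ?_
    obtain ⟨d, hcd, hd⟩ := exists_between hc
    have hdt : d ≠ ⊤ := hd.ne_top
    rw [← ENNReal.ofReal_toReal hdt] at hd
    obtain ⟨R, hR⟩ := exists_isMildSolution hS0 ENNReal.toReal_nonneg
      (small_of_lt_existenceConst ENNReal.toReal_nonneg hd)
    rw [ENNReal.ofReal_toReal hdt] at hR
    exact hcd.trans_le (le_sSup ⟨R, hR⟩)
  · refine IsMildSolution.of_forall_exists hinit fun t h0 ht => ?_
    obtain ⟨T, ⟨R, hR⟩, hT⟩ := lt_sSup_iff.1 ht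
    exact ⟨T, hT, hR.congr hinit fun s hs hs' => (huniq T R hR s hs hs').symm⟩

/-! ### Weighted estimates -/

/-- The weight `(1 + t min(2π|ξ|, N))ⁿ`. -/
noncomputable def truncWeight (n N : ℕ) (t : ℝ) (ξ : E3) : ℝ :=
  (1 + t * min (2 * Real.pi * ‖ξ‖) N) ^ n

theorem one_le_truncWeight_base (N : ℕ) {t : ℝ} (ht : 0 ≤ t) (ξ : E3) :
    1 ≤ 1 + t * min (2 * Real.pi * ‖ξ‖) N := by
  have : 0 ≤ min (2 * Real.pi * ‖ξ‖) (N : ℝ) := le_min (by positivity) (by positivity)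
  nlinarith [mul_nonneg ht this]

theorem truncWeight_nonneg (n N : ℕ) {t : ℝ} (ht : 0 ≤ t) (ξ : E3) : 0 ≤ truncWeight n N t ξ :=
  pow_nonneg (zero_le_one.trans (one_le_truncWeight_base N ht ξ)) n

theorem truncWeight_neg (n N : ℕ) (t : ℝ) (ξ : E3) :
    truncWeight n N t (-ξ) = truncWeight n N t ξ := by
  simp [truncWeight]

theorem continuous_truncWeight (n N : ℕ) (t : ℝ) : Continuous (truncWeight n N t) := by
  unfold truncWeight
  fun_prop

theorem truncWeight_le (n N : ℕ) {t : ℝ} (ht : 0 ≤ t) (ξ : E3) :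
    truncWeight n N t ξ ≤ (1 + t * N) ^ n :=
  pow_le_pow_left₀ (zero_le_one.trans (one_le_truncWeight_base N ht ξ))
    (add_le_add_right (mul_le_mul_of_nonneg_left (min_le_right _ _) ht) 1) n

theorem memLp_truncWeight (n N : ℕ) {t : ℝ} (ht : 0 ≤ t) : MemLp (truncWeight n N t) ∞ :=
  memLp_top_of_bound (continuous_truncWeight n N t).aestronglyMeasurable ((1 + t * N) ^ n)
    (Eventually.of_forall fun ξ => by
      rw [Real.norm_of_nonneg (truncWeight_nonneg n N ht ξ)]
      exact truncWeight_le n N ht ξ)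

/-- From `1 + (s + t)k ≤ (1 + sk)(1 + tk)`. In Duhamel's formula this shares the weight between the
heat kernel and the earlier solution. -/
theorem truncWeight_add_time_le (n N : ℕ) {s t : ℝ} (hs : 0 ≤ s) (ht : 0 ≤ t) (ξ : E3) :
    truncWeight n N (s + t) ξ ≤ truncWeight n N s ξ * truncWeight n N t ξ := by
  rw [truncWeight, truncWeight, truncWeight, ← mul_pow]
  refine pow_le_pow_left₀ (zero_le_one.trans
    (one_le_truncWeight_base N (add_nonneg hs ht) ξ)) ?_ n
  have : 0 ≤ min (2 * Real.pi * ‖ξ‖) (N : ℝ) := le_min (by positivity) (by positivity)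
  nlinarith [mul_nonneg (mul_nonneg hs this) (mul_nonneg ht this)]

/-- Truncating `|ξ|` at `N` keeps it subadditive, and `ξ = (η + ξ) - η`; the constant does not
depend on `N`. -/
theorem truncWeight_le_add (n N : ℕ) {t : ℝ} (ht : 0 ≤ t) (ξ η : E3) :
    truncWeight n N t ξ ≤ 2 ^ n * (truncWeight n N t η + truncWeight n N t (η + ξ)) := by
  have h1 : ‖ξ‖ ≤ ‖η‖ + ‖η + ξ‖ := by
    have := norm_sub_le (η + ξ) η
    rw [add_sub_cancel_left] at this
    linarith
  have h2 : min (2 * Real.pi * ‖ξ‖) (N : ℝ) ≤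
      min (2 * Real.pi * ‖η‖) N + min (2 * Real.pi * ‖η + ξ‖) N := by
    have hN : (0 : ℝ) ≤ N := by positivity
    have a : 0 ≤ 2 * Real.pi * ‖η‖ := by positivity
    have b : 0 ≤ 2 * Real.pi * ‖η + ξ‖ := by positivity
    have c : 2 * Real.pi * ‖ξ‖ ≤ 2 * Real.pi * ‖η‖ + 2 * Real.pi * ‖η + ξ‖ := by
      rw [← mul_add]
      gcongr
    rcases min_cases (2 * Real.pi * ‖η‖) (N : ℝ) with h | h <;>
    rcases min_cases (2 * Real.pi * ‖η + ξ‖) (N : ℝ) with h' | h' <;>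
    rcases min_cases (2 * Real.pi * ‖ξ‖) (N : ℝ) with h'' | h'' <;> linarith
  have h3 := one_le_truncWeight_base N ht η
  have h4 := one_le_truncWeight_base N ht (η + ξ)
  have h5 := one_le_truncWeight_base N ht ξ
  unfold truncWeight
  calc (1 + t * min (2 * Real.pi * ‖ξ‖) (N : ℝ)) ^ n
      ≤ ((1 + t * min (2 * Real.pi * ‖η‖) N) + (1 + t * min (2 * Real.pi * ‖η + ξ‖) N)) ^ n := by
        refine pow_le_pow_left₀ (by linarith) ?_ n
        nlinarith [mul_le_mul_of_nonneg_left h2 ht]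
    _ ≤ 2 ^ (n - 1) * _ := add_pow_le (by linarith) (by linarith) n
    _ ≤ _ := by
        gcongr
        · norm_num
        · exact Nat.sub_le n 1

/-- With `k = 2π|ξ|`, use `xⁿ ≤ n! eˣ` and `tk ≤ t/2 + tk²/2`. Half of the Gaussian pays for the
weight and half remains, uniformly in `N`. -/
theorem truncWeight_mul_heatSymbol_le (n N : ℕ) {t T : ℝ} (ht : 0 ≤ t) (hT : t ≤ T) (ξ : E3) :
    truncWeight n N t ξ * heatSymbol t ξ ≤
      n.factorial * Real.exp (1 + T / 2) * heatSymbol (t / 2) ξ := by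
  have h1 := one_le_truncWeight_base N ht ξ
  have h2 : truncWeight n N t ξ ≤
      n.factorial * Real.exp (1 + t * min (2 * Real.pi * ‖ξ‖) N) := by
    have := Real.pow_div_factorial_le_exp _ (zero_le_one.trans h1) n
    rw [div_le_iff₀ (by positivity)] at this
    exact this.trans (mul_comm _ _).le
  have h3 : t * min (2 * Real.pi * ‖ξ‖) N ≤ T / 2 + t / 2 * (2 * Real.pi * ‖ξ‖) ^ 2 := by
    have := mul_le_mul_of_nonneg_left (min_le_left (2 * Real.pi * ‖ξ‖) (N : ℝ)) ht
    nlinarith [mul_nonneg ht (sq_nonneg (2 * Real.pi * ‖ξ‖ - 1))]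
  calc truncWeight n N t ξ * heatSymbol t ξ
      ≤ n.factorial * Real.exp (1 + t * min (2 * Real.pi * ‖ξ‖) N) * heatSymbol t ξ :=
        mul_le_mul_of_nonneg_right h2 (heatSymbol_nonneg t ξ)
    _ ≤ n.factorial * Real.exp (1 + (T / 2 + t / 2 * (2 * Real.pi * ‖ξ‖) ^ 2)) *
        heatSymbol t ξ := by
        have := heatSymbol_nonneg t ξ
        gcongr
    _ = _ := by
        rw [heatSymbol, heatSymbol, mul_assoc _ (Real.exp _), mul_assoc _ (Real.exp _),
          ← Real.exp_add, ← Real.exp_add]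
        ring_nf

/-! ### The Fourier transform of the square -/

theorem lintegral_enorm_mul_le (f g : L2CMat) :
    ∫⁻ x, ‖f x‖ₑ * ‖g x‖ₑ ≤ ENNReal.ofReal (‖f‖ * ‖g‖) := by
  have h := ENNReal.lintegral_mul_le_Lp_mul_Lq (volume : Measure E3) Real.HolderConjugate.two_two
    (Lp.aestronglyMeasurable f).enorm (Lp.aestronglyMeasurable g).enorm
  have e : ∀ f : L2CMat, (∫⁻ x, ‖f x‖ₑ ^ (2 : ℝ)) ^ (1 / (2 : ℝ)) = ENNReal.ofReal ‖f‖ := by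
    intro f
    simp only [ENNReal.rpow_two]
    rw [← norm_sq_L2, ENNReal.ofReal_pow (norm_nonneg _), ← ENNReal.rpow_natCast,
      ← ENNReal.rpow_mul]
    norm_num
  rw [e, e, ← ENNReal.ofReal_mul (norm_nonneg _)] at h
  exact h

/-- Transposition of matrices. -/
noncomputable def transposeMat : CMat3 →L[ℂ] CMat3 :=
  LinearMap.toContinuousLinearMap
    { toFun := fun A => WithLp.toLp 2 fun p => A p.swap
      map_add' := fun A B => by ext p; simp
      map_smul' := fun c A => by ext p; simp }

theorem transposeMat_apply (A : CMat3) (p : Fin 3 × Fin 3) : transposeMat A p = A p.swap := rfl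

theorem norm_transposeMat (A : CMat3) : ‖transposeMat A‖ = ‖A‖ := by
  rw [EuclideanSpace.norm_eq, EuclideanSpace.norm_eq]
  congr 1
  exact Equiv.sum_comp (Equiv.prodComm (Fin 3) (Fin 3)) fun p => ‖A p‖ ^ 2

theorem complexify_matSq (A : Mat3) :
    complexify (matSq A) = matMul ℂ (complexify A) (complexify A) := by
  ext p
  simp [matSq, matMul_apply]

/-- The adjoint of left multiplication by a real matrix is multiplication by its transpose. -/
theorem inner_matMul_complexify (A : CMat3) (M : Mat3) :
    inner ℂ A (matMul ℂ (complexify M) (complexify M)) =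
      inner ℂ (matMul ℂ (transposeMat (complexify M)) A) (complexify M) := by
  simp only [PiLp.inner_apply, matMul_apply, RCLike.inner_apply, transposeMat_apply,
    complexify_apply, map_sum, map_mul, Complex.conj_ofReal, Fintype.sum_prod_type,
    Finset.sum_mul, Finset.mul_sum, Prod.swap_prod_mk]
  rw [Finset.sum_comm]
  conv_rhs => rw [Finset.sum_comm]
  refine Finset.sum_congr rfl fun j _ => ?_
  rw [Finset.sum_comm]
  refine Finset.sum_congr rfl fun k _ => Finset.sum_congr rfl fun i _ => ?_
  ring

/-- Pairing the value `A` with itself gives `|A|² = ⟨Sᵀ A, e^{-2πi x·ξ} S⟩`, an `L²` inner product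
to which Plancherel applies. Dividing by `|A|` yields the bound without forming a convolution of
transforms. -/
theorem enorm_fourier_sqL1_le (S : L2Mat) (ξ : E3) :
    ‖𝓕 (fun x => complexify (sqL1 S x)) ξ‖ₑ ≤
      ∫⁻ η, ‖fourierMat S η‖ₑ * ‖fourierMat S (η + ξ)‖ₑ := by
  set A : CMat3 := 𝓕 (fun x => complexify (sqL1 S x)) ξ with hA
  let L : CMat3 →L[ℂ] CMat3 := ((matMul ℂ).flip A).comp transposeMat
  have hL : ∀ M, L M = matMul ℂ (transposeMat M) A := fun M => rfl
  set f : L2CMat := complexify.compLp S with hf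
  have hint : Integrable fun x => character ξ x • complexify (sqL1 S x) :=
    (Real.fourierIntegral_convergent_iff (μ := volume) ξ).2
      (complexify.integrable_comp (memLp_one_iff_integrable.1 (Lp.memLp (sqL1 S))))
  have h1 : inner ℂ A A = inner ℂ (L.compLp f) (boundedMul _ (memLp_character ξ) f) := by
    have e1 : inner ℂ A A = ∫ x, inner ℂ A (character ξ x • complexify (sqL1 S x)) := by
      rw [integral_inner hint]
      rfl
    rw [e1, L2.inner_def]
    refine integral_congr_ae ?_
    filter_upwards [(memLp_matSq S).coeFn_toLp, L.coeFn_compLp f,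
      coeFn_boundedMul (memLp_character ξ) f, complexify.coeFn_compLp S] with x a b c d
    have a' : sqL1 S x = matSq (S x) := a
    rw [b, c, hf, d, a', inner_smul_right, inner_smul_right, complexify_matSq,
      inner_matMul_complexify, hL]
  rw [← Lp.inner_fourier_eq, fourier_compLp, fourier_modulation, L2.inner_def] at h1
  have h2 : ‖A‖ₑ * ‖A‖ₑ ≤ ‖A‖ₑ * ∫⁻ η, ‖fourierMat S η‖ₑ * ‖fourierMat S (η + ξ)‖ₑ := by
    have e2 : ‖A‖ₑ * ‖A‖ₑ = ‖(inner ℂ A A : ℂ)‖ₑ := by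
      rw [inner_self_eq_norm_sq_to_K, ← sq, ← ofReal_norm, ← ofReal_norm]
      simp
    rw [e2, h1, ← lintegral_const_mul' _ _ enorm_ne_top]
    refine (enorm_integral_le_lintegral_enorm _).trans (lintegral_mono_ae ?_)
    filter_upwards [L.coeFn_compLp (𝓕 f : L2CMat), coeFn_translateL2 ξ (𝓕 f : L2CMat)] with η a b
    rw [a, b, ← ofReal_norm, ← ofReal_norm, ← ofReal_norm, ← ofReal_norm,
      ← ENNReal.ofReal_mul (norm_nonneg _), ← ENNReal.ofReal_mul (norm_nonneg _)]
    refine ENNReal.ofReal_le_ofReal ((norm_inner_le_norm _ _).trans ?_)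
    rw [← mul_assoc, hL]
    refine mul_le_mul_of_nonneg_right ((norm_matMul_le _ _).trans (le_of_eq ?_)) (norm_nonneg _)
    rw [norm_transposeMat, mul_comm]
    rfl
  rcases eq_or_ne A 0 with h0 | h0
  · simp [h0]
  · exact (ENNReal.mul_le_mul_iff_right (enorm_ne_zero.2 h0) enorm_ne_top).1 h2

/-- The weight falls on one factor at a time, followed by Cauchy–Schwarz. The bound is linear in the
weighted norm, so the later Gronwall argument is linear too. -/
theorem weight_mul_norm_fourier_sqL1_le {w : E3 → ℝ} (hw : MemLp w ∞) (he : ∀ ξ, w (-ξ) = w ξ)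
    (h0 : ∀ ξ, 0 ≤ w ξ) {c : ℝ} (hc : 0 ≤ c) (hadd : ∀ ξ η, w ξ ≤ c * (w η + w (η + ξ)))
    (S : L2Mat) (ξ : E3) :
    w ξ * ‖𝓕 (fun x => complexify (sqL1 S x)) ξ‖ ≤ 2 * c * (‖S‖ * ‖fourierMul w hw S‖) := by
  have hwS := fourierMat_fourierMul hw he S
  have hsh := measurePreserving_add_right (volume : Measure E3) ξ
  have hwS' := hsh.quasiMeasurePreserving.ae_eq_comp hwS
  have ht := coeFn_translateL2 ξ (fourierMat S)
  have ht' := coeFn_translateL2 ξ (fourierMat (fourierMul w hw S))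
  have hen : ∀ η, ‖((w η : ℝ) : ℂ)‖ₑ = ENNReal.ofReal (w η) := fun η => by
    rw [← ofReal_norm, Complex.norm_real, Real.norm_of_nonneg (h0 η)]
  have key : ENNReal.ofReal (w ξ) * ‖𝓕 (fun x => complexify (sqL1 S x)) ξ‖ₑ ≤
      ENNReal.ofReal c * (ENNReal.ofReal (‖S‖ * ‖fourierMul w hw S‖) +
        ENNReal.ofReal (‖S‖ * ‖fourierMul w hw S‖)) := by
    calc _ ≤ ENNReal.ofReal (w ξ) * ∫⁻ η, ‖fourierMat S η‖ₑ * ‖fourierMat S (η + ξ)‖ₑ := by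
          gcongr
          exact enorm_fourier_sqL1_le S ξ
      _ = ∫⁻ η, ENNReal.ofReal (w ξ) * (‖fourierMat S η‖ₑ * ‖fourierMat S (η + ξ)‖ₑ) :=
          (lintegral_const_mul' _ _ ENNReal.ofReal_ne_top).symm
      _ ≤ ∫⁻ η, ENNReal.ofReal c * (‖fourierMat (fourierMul w hw S) η‖ₑ *
            ‖translateL2 ξ (fourierMat S) η‖ₑ + ‖fourierMat S η‖ₑ *
            ‖translateL2 ξ (fourierMat (fourierMul w hw S)) η‖ₑ) := by
          refine lintegral_mono_ae ?_
          filter_upwards [hwS, hwS', ht, ht'] with η a b d e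
          simp only [Function.comp_apply] at b
          rw [d, e, a, b, enorm_smul, enorm_smul, hen, hen]
          calc _ ≤ ENNReal.ofReal (c * (w η + w (η + ξ))) *
                (‖fourierMat S η‖ₑ * ‖fourierMat S (η + ξ)‖ₑ) := by
                gcongr
                exact hadd ξ η
            _ = _ := by
                rw [ENNReal.ofReal_mul hc, ENNReal.ofReal_add (h0 _) (h0 _)]
                ring
      _ = ENNReal.ofReal c * ((∫⁻ η, ‖fourierMat (fourierMul w hw S) η‖ₑ *
            ‖translateL2 ξ (fourierMat S) η‖ₑ) + ∫⁻ η, ‖fourierMat S η‖ₑ *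
            ‖translateL2 ξ (fourierMat (fourierMul w hw S)) η‖ₑ) := by
          rw [lintegral_const_mul' _ _ ENNReal.ofReal_ne_top, lintegral_add_left']
          exact (Lp.aestronglyMeasurable _).enorm.mul (Lp.aestronglyMeasurable _).enorm
      _ ≤ _ := by
          gcongr
          · refine (lintegral_enorm_mul_le _ _).trans (le_of_eq ?_)
            rw [LinearIsometry.norm_map, norm_fourierMat, norm_fourierMat, mul_comm]
          · refine (lintegral_enorm_mul_le _ _).trans (le_of_eq ?_)
            rw [LinearIsometry.norm_map, norm_fourierMat, norm_fourierMat]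
  rw [← ofReal_norm, ← ENNReal.ofReal_mul (h0 ξ), ← ENNReal.ofReal_add (by positivity)
    (by positivity), ← ENNReal.ofReal_mul hc, ENNReal.ofReal_le_ofReal_iff (by positivity)] at key
  linarith

/-! ### Smoothing -/

theorem integral_heatSymbol {t : ℝ} (ht : 0 < t) :
    Integrable (heatSymbol t) ∧ ∫ ξ, heatSymbol t ξ = (4 * Real.pi * t) ^ (-(3 / 2) : ℝ) := by
  have e : heatSymbol t = fun ξ : E3 => Real.exp (-(4 * Real.pi ^ 2 * t) * ‖ξ‖ ^ 2) := by
    funext ξ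
    rw [heatSymbol]
    congr 1
    ring
  have hI : ∫ ξ, heatSymbol t ξ = (4 * Real.pi * t) ^ (-(3 / 2) : ℝ) := by
    rw [e, GaussianFourier.integral_rexp_neg_mul_sq_norm (by positivity)]
    have e3 : ((Module.finrank ℝ E3 : ℕ) : ℝ) / 2 = 3 / 2 := by simp
    have e4 : Real.pi / (4 * Real.pi ^ 2 * t) = (4 * Real.pi * t)⁻¹ := by
      field_simp
    rw [e3, e4, Real.inv_rpow (by positivity), Real.rpow_neg (by positivity)]
  -- A non-integrable function has integral 0 by convention, so the positive value just found forces
  -- integrability.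
  refine ⟨not_imp_comm.1 integral_undef ?_, hI⟩
  rw [hI]
  positivity

/-- The square of the majorant is `c²` times the symbol at time `t`, with integral `c²
(4πt)^{-3/2}`. This gives the singularity `t^{-3/4}` again, now from a pointwise frequency bound. -/
theorem norm_le_of_norm_le_heatSymbol {f : L2CMat} {t c : ℝ} (ht : 0 < t) (hc : 0 ≤ c)
    (h : ∀ᵐ ξ, ‖f ξ‖ ≤ c * heatSymbol (t / 2) ξ) :
    ‖f‖ ≤ c * (4 * Real.pi * t) ^ (-(3 / 4) : ℝ) := by
  obtain ⟨hi, hI⟩ := integral_heatSymbol ht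
  refine le_of_sq_le_sq ?_ (by positivity)
  rw [← ENNReal.ofReal_le_ofReal_iff (by positivity), norm_sq_L2]
  calc ∫⁻ ξ, ‖f ξ‖ₑ ^ 2 ≤ ∫⁻ ξ, ENNReal.ofReal (c ^ 2 * heatSymbol t ξ) := by
        refine lintegral_mono_ae (h.mono fun ξ hξ => ?_)
        rw [← ofReal_norm, ← ENNReal.ofReal_pow (norm_nonneg _)]
        refine ENNReal.ofReal_le_ofReal ?_
        have e : heatSymbol t ξ = heatSymbol (t / 2) ξ ^ 2 := by
          rw [sq, ← heatSymbol_add, add_halves]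
        rw [e, ← mul_pow]
        exact pow_le_pow_left₀ (norm_nonneg _) hξ 2
    _ = ENNReal.ofReal (∫ ξ, c ^ 2 * heatSymbol t ξ) :=
        (ofReal_integral_eq_lintegral_ofReal (hi.const_mul _) (Eventually.of_forall fun ξ =>
          mul_nonneg (sq_nonneg _) (heatSymbol_nonneg t ξ))).symm
    _ = _ := by
        rw [integral_const_mul, hI, mul_pow, ← Real.rpow_natCast (_ ^ _),
          ← Real.rpow_mul (by positivity)]
        norm_num

theorem norm_fourierMul_duhamelKernel_le (n N : ℕ) {s t T : ℝ} (hs : 0 ≤ s) (ht : 0 < t)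
    (hT : t ≤ T) (hst : 0 ≤ t + s) (S : L2Mat) :
    ‖fourierMul _ (memLp_truncWeight n N hst) (duhamelKernel t S)‖ ≤
      n.factorial * Real.exp (1 + T / 2) * 2 ^ (n + 1) * (4 * Real.pi) ^ (-(3 / 4) : ℝ) *
        t ^ (-(3 / 4) : ℝ) * (‖S‖ * ‖fourierMul _ (memLp_truncWeight n N hs) S‖) := by
  rw [duhamelKernel, ← Pst_fourierMul _ (truncWeight_neg n N _)]
  refine (norm_Pst_le _).trans ?_
  rw [← norm_fourierMat]
  set Y := ‖S‖ * ‖fourierMul _ (memLp_truncWeight n N hs) S‖ with hY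
  have hY0 : 0 ≤ Y := by positivity
  refine (norm_le_of_norm_le_heatSymbol (t := t)
    (c := n.factorial * Real.exp (1 + T / 2) * (2 ^ (n + 1) * Y)) ht (by positivity) ?_).trans
    (le_of_eq ?_)
  · filter_upwards [fourierMat_fourierMul (memLp_truncWeight n N hst) (truncWeight_neg n N _)
      (heatL1 t (sqL1 S)), fourierMat_heatL1 ht (sqL1 S)] with ξ a b
    rw [a, b, norm_smul, norm_smul, Complex.norm_real, Complex.norm_real,
      Real.norm_of_nonneg (truncWeight_nonneg n N hst ξ),
      Real.norm_of_nonneg (heatSymbol_nonneg t ξ)]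
    have h1 := truncWeight_add_time_le n N ht.le hs ξ
    have h2 := truncWeight_mul_heatSymbol_le n N ht.le hT ξ
    have h3 := weight_mul_norm_fourier_sqL1_le (memLp_truncWeight n N hs) (truncWeight_neg n N s)
      (truncWeight_nonneg n N hs) (c := 2 ^ n) (by positivity) (truncWeight_le_add n N hs) S ξ
    rw [← hY, ← pow_succ'] at h3
    have h4 := heatSymbol_nonneg t ξ
    have h5 := heatSymbol_nonneg (t / 2) ξ
    have h6 := truncWeight_nonneg n N hs ξ
    set z := ‖𝓕 (fun x => complexify (sqL1 S x)) ξ‖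
    have hz : 0 ≤ z := norm_nonneg _
    calc truncWeight n N (t + s) ξ * (heatSymbol t ξ * z)
        ≤ truncWeight n N t ξ * truncWeight n N s ξ * (heatSymbol t ξ * z) := by gcongr
      _ = (truncWeight n N t ξ * heatSymbol t ξ) * (truncWeight n N s ξ * z) := by ring
      _ ≤ (n.factorial * Real.exp (1 + T / 2) * heatSymbol (t / 2) ξ) * (2 ^ (n + 1) * Y) := by
          gcongr
      _ = _ := by ring
  · rw [Real.mul_rpow (by positivity) ht.le]
    ring

theorem norm_fourierMul_heatL2_le (n N : ℕ) {t T : ℝ} (ht : 0 ≤ t) (hT : t ≤ T) (S : L2Mat) :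
    ‖fourierMul _ (memLp_truncWeight n N ht) (heatL2 t S)‖ ≤
      n.factorial * Real.exp (1 + T / 2) * ‖S‖ := by
  have hc : (0 : ℝ) ≤ n.factorial * Real.exp (1 + T / 2) := by positivity
  rw [← norm_fourierMat, ← norm_fourierMat S, ← Real.norm_of_nonneg hc, ← norm_smul]
  refine Lp.norm_le_norm_of_ae_le ?_
  filter_upwards [fourierMat_fourierMul (memLp_truncWeight n N ht) (truncWeight_neg n N t)
    (heatL2 t S), fourierMat_heatL2 ht S, Lp.coeFn_smul ((n.factorial : ℝ) * Real.exp (1 + T / 2))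
      (fourierMat S)] with ξ a b c
  rw [a, b, c, Pi.smul_apply, norm_smul, norm_smul, norm_smul, Complex.norm_real,
    Complex.norm_real, Real.norm_of_nonneg (truncWeight_nonneg n N ht ξ),
    Real.norm_of_nonneg (heatSymbol_nonneg t ξ), Real.norm_of_nonneg hc, ← mul_assoc]
  refine mul_le_mul_of_nonneg_right ?_ (norm_nonneg _)
  refine (truncWeight_mul_heatSymbol_le n N ht hT ξ).trans (mul_le_of_le_one_right hc ?_)
  exact heatSymbol_le_one (by positivity) ξ

namespace IsMildSolution

variable {S0 : L2Mat} {T : ℝ≥0∞} {S : ℝ → L2Mat}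

/-- The iteration lemma is applied to the weighted norm. Its a priori bound `Y` depends on `N`, but
`A` and `r` do not, and only these survive in `B`. -/
theorem exists_truncWeight_bound (h : IsMildSolution S0 T S) {t₁ : ℝ} (h0 : 0 ≤ t₁)
    (h1 : ENNReal.ofReal t₁ < T) (n : ℕ) : ∃ B : ℝ, ∀ (N : ℕ) (t : ℝ) (ht : 0 ≤ t), t ≤ t₁ →
      ‖fourierMul _ (memLp_truncWeight n N ht) (S t)‖ ≤ B := by
  have hSc := h.continuousOn_Icc h1
  obtain ⟨M, hM⟩ := isCompact_Icc.exists_bound_of_continuousOn hSc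
  have hM0 : 0 ≤ M := (norm_nonneg _).trans (hM 0 ⟨le_rfl, h0⟩)
  set C : ℝ := n.factorial * Real.exp (1 + t₁ / 2) with hC
  set K : ℝ := C * 2 ^ (n + 1) * (4 * Real.pi) ^ (-(3 / 4) : ℝ) with hK
  obtain ⟨r, hr, hI⟩ := exists_rate (K * M) (by positivity)
  refine ⟨2 * (C * ‖S0‖) * Real.exp (r * t₁), fun N t ht htt => ?_⟩
  -- The weight is a bounded multiplier only for `0 ≤ t`; the value at negative times is irrelevant.
  let y : ℝ → ℝ := fun t =>
    if ht : 0 ≤ t then ‖fourierMul _ (memLp_truncWeight n N ht) (S t)‖ else 0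
  have hy : ∀ {t} (ht : 0 ≤ t), y t = ‖fourierMul _ (memLp_truncWeight n N ht) (S t)‖ :=
    fun ht => dif_pos ht
  have key := le_of_forall_improve (s := Set.Icc 0 t₁) (y := y) (A := C * ‖S0‖)
    (Y := (1 + t₁ * N) ^ n * M) (r := r) (fun s hs => hs.1) (by positivity) hr.le (by positivity)
    (fun s hs => ?_) ?_
  · have hk := key t ⟨ht, htt⟩
    rw [hy ht] at hk
    refine hk.trans ?_
    gcongr
  · rw [hy hs.1]
    refine (norm_fourierMul_le _ (truncWeight_neg n N s) (c := (1 + t₁ * N) ^ n) (by positivity)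
      (fun ξ => ?_) _).trans ?_
    · rw [abs_of_nonneg (truncWeight_nonneg n N hs.1 ξ)]
      refine (truncWeight_le n N hs.1 ξ).trans ?_
      have := hs.1
      have := hs.2
      gcongr
    · gcongr
      exact hM s hs
  intro E hE hyp s hs
  have hsub : Set.Icc 0 s ⊆ Set.Icc 0 t₁ := Set.Icc_subset_Icc_right hs.2
  have hle := ENNReal.ofReal_le_ofReal hs.2
  have hint := intervalIntegrable_duhamelKernel hs.1 (hSc.mono hsub)
  have h2 := hI (f := fun τ => fourierMul _ (memLp_truncWeight n N hs.1)
      (duhamelKernel τ (S (s - τ)))) hs.1 hE fun τ hτ => by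
    have h0τ : 0 ≤ τ := hτ.1.le
    have hsτ : 0 ≤ s - τ := sub_nonneg.2 hτ.2
    have hm : s - τ ∈ Set.Icc 0 t₁ := ⟨hsτ, (sub_le_self _ h0τ).trans hs.2⟩
    have h3 := norm_fourierMul_duhamelKernel_le n N hsτ hτ.1 (hτ.2.trans hs.2)
      (by rw [add_sub_cancel]; exact hs.1) (S (s - τ))
    simp only [add_sub_cancel] at h3
    have h4 := hyp _ hm
    rw [hy hsτ] at h4
    have h5 := hM _ hm
    refine h3.trans ?_
    rw [← hC, ← hK]
    calc _ ≤ K * τ ^ (-(3 / 4) : ℝ) * (M * (E * Real.exp (r * (s - τ)))) := by gcongr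
      _ = _ := by ring
  -- The truncation makes the weight a bounded operator, so it can be pulled out of the Bochner
  -- integral.
  rw [ContinuousLinearMap.intervalIntegral_comp_comm _ hint] at h2
  rw [hy hs.1, h.eq_duhamelMap hs.1 (hle.trans_lt h1), duhamelMap, map_sub, map_smul]
  refine (norm_sub_le _ _).trans (add_le_add (norm_fourierMul_heatL2_le n N hs.1 hs.2 _) ?_)
  rw [norm_smul, Real.norm_of_nonneg (by norm_num)]
  have := norm_nonneg (fourierMul _ (memLp_truncWeight n N hs.1)
    (∫ τ in (0 : ℝ)..s, duhamelKernel τ (S (s - τ))))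
  linarith

end IsMildSolution

/-! ### Moments of the Fourier transform -/

/-- The squared weighted norm `∫ (1 + t·2π|ξ|)^{2n} |f̂(ξ)|² dξ`. -/
noncomputable def fourierMoment (n : ℕ) (t : ℝ) (f : L2Mat) : ℝ≥0∞ :=
  ∫⁻ ξ, ENNReal.ofReal ((1 + t * (2 * Real.pi * ‖ξ‖)) ^ n) ^ 2 * ‖fourierMat f ξ‖ₑ ^ 2

theorem aemeasurable_enorm_fourierMat (f : L2Mat) :
    AEMeasurable (fun ξ => ‖fourierMat f ξ‖ₑ) volume :=
  (Lp.aestronglyMeasurable (fourierMat f)).enorm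

/-- Monotone convergence in `N`: at each frequency the weights increase and are eventually constant.
-/
theorem fourierMoment_le_of_truncWeight {n : ℕ} {t B : ℝ} (ht : 0 ≤ t) {f : L2Mat}
    (h : ∀ N, ‖fourierMul _ (memLp_truncWeight n N ht) f‖ ≤ B) :
    fourierMoment n t f ≤ ENNReal.ofReal (B ^ 2) := by
  have hN : ∀ N, ∫⁻ ξ, ENNReal.ofReal (truncWeight n N t ξ) ^ 2 * ‖fourierMat f ξ‖ₑ ^ 2 ≤
      ENNReal.ofReal (B ^ 2) := by
    intro N
    have e : ∫⁻ ξ, ENNReal.ofReal (truncWeight n N t ξ) ^ 2 * ‖fourierMat f ξ‖ₑ ^ 2 =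
        ENNReal.ofReal (‖fourierMul _ (memLp_truncWeight n N ht) f‖ ^ 2) := by
      rw [← norm_fourierMat, norm_sq_L2]
      refine lintegral_congr_ae ?_
      filter_upwards [fourierMat_fourierMul (memLp_truncWeight n N ht) (truncWeight_neg n N t) f]
        with ξ a
      rw [a, enorm_smul, mul_pow, ← ofReal_norm (_ : ℂ), Complex.norm_real,
        Real.norm_of_nonneg (truncWeight_nonneg n N ht ξ)]
    rw [e]
    exact ENNReal.ofReal_le_ofReal (pow_le_pow_left₀ (norm_nonneg _) (h N) 2)
  have hlim : Tendsto (fun N : ℕ => ∫⁻ ξ, ENNReal.ofReal (truncWeight n N t ξ) ^ 2 *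
      ‖fourierMat f ξ‖ₑ ^ 2) atTop (𝓝 (fourierMoment n t f)) := by
    refine lintegral_tendsto_of_tendsto_of_monotone (fun N => ?_) ?_ ?_
    · exact ((continuous_truncWeight n N t).measurable.ennreal_ofReal.pow_const
        2).aemeasurable.mul ((aemeasurable_enorm_fourierMat f).pow_const 2)
    · refine Eventually.of_forall fun ξ N N' hNN => ?_
      have h1 := one_le_truncWeight_base N ht ξ
      simp only [truncWeight]
      gcongr
    · refine Eventually.of_forall fun ξ => tendsto_const_nhds.congr' ?_
      obtain ⟨N₀, hN₀⟩ := exists_nat_ge (2 * Real.pi * ‖ξ‖)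
      filter_upwards [eventually_ge_atTop N₀] with N hNN
      rw [truncWeight, min_eq_left (hN₀.trans (by exact_mod_cast hNN))]
  exact le_of_tendsto' hlim hN

/-- `1 + k ≤ (1 + 1/t₀)(1 + tk)` trades the time-dependent weight for a fixed one, at a cost that
blows up as `t₀ → 0`. -/
theorem fourierMoment_one_le {n : ℕ} {t t₀ : ℝ} (h0 : 0 < t₀) (ht : t₀ ≤ t) (f : L2Mat) :
    fourierMoment n 1 f ≤ ENNReal.ofReal ((1 + 1 / t₀) ^ n) ^ 2 * fourierMoment n t f := by
  rw [fourierMoment, fourierMoment,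
    ← lintegral_const_mul' _ _ (ENNReal.pow_ne_top ENNReal.ofReal_ne_top)]
  refine lintegral_mono fun ξ => ?_
  have hk : 0 ≤ 2 * Real.pi * ‖ξ‖ := by positivity
  set k := 2 * Real.pi * ‖ξ‖
  have h1 : k ≤ 1 / t₀ * (t * k) := by
    have := mul_le_mul_of_nonneg_right ht hk
    rw [one_div, ← div_eq_inv_mul, le_div_iff₀ h0]
    linarith
  have h2 : 0 ≤ 1 / t₀ := by positivity
  have h3 : 0 ≤ t * k := mul_nonneg (h0.le.trans ht) hk
  have h4 : ENNReal.ofReal ((1 + 1 * k) ^ n) ≤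
      ENNReal.ofReal ((1 + 1 / t₀) ^ n) * ENNReal.ofReal ((1 + t * k) ^ n) := by
    rw [← ENNReal.ofReal_mul (by positivity), ← mul_pow]
    gcongr
    linarith
  calc _ ≤ (ENNReal.ofReal ((1 + 1 / t₀) ^ n) * ENNReal.ofReal ((1 + t * k) ^ n)) ^ 2 *
        ‖fourierMat f ξ‖ₑ ^ 2 := by gcongr
    _ = _ := by ring

theorem IsMildSolution.exists_fourierMoment_bound {S0 : L2Mat} {T : ℝ≥0∞} {S : ℝ → L2Mat}
    (h : IsMildSolution S0 T S) {t₀ t₁ : ℝ} (h0 : 0 < t₀) (h01 : t₀ ≤ t₁)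
    (h1 : ENNReal.ofReal t₁ < T) (n : ℕ) :
    ∃ B : ℝ≥0∞, B ≠ ⊤ ∧ ∀ t ∈ Set.Icc t₀ t₁, fourierMoment n 1 (S t) ≤ B := by
  obtain ⟨B, hB⟩ := h.exists_truncWeight_bound (h0.le.trans h01) h1 n
  refine ⟨ENNReal.ofReal ((1 + 1 / t₀) ^ n) ^ 2 * ENNReal.ofReal (B ^ 2),
    ENNReal.mul_ne_top (ENNReal.pow_ne_top ENNReal.ofReal_ne_top) ENNReal.ofReal_ne_top,
    fun t ht => ?_⟩
  refine (fourierMoment_one_le h0 ht.1 _).trans ?_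
  gcongr
  exact fourierMoment_le_of_truncWeight (h0.le.trans ht.1) fun N => hB N t (h0.le.trans ht.1) ht.2

theorem fourierMoment_sub_le (n : ℕ) (t : ℝ) (f g : L2Mat) :
    fourierMoment n t (f - g) ≤ 2 * fourierMoment n t f + 2 * fourierMoment n t g := by
  have hm : Continuous fun ξ : E3 =>
      ENNReal.ofReal ((1 + t * (2 * Real.pi * ‖ξ‖)) ^ n) :=
    ENNReal.continuous_ofReal.comp (by fun_prop)
  rw [fourierMoment, fourierMoment, fourierMoment, ← lintegral_const_mul' _ _ (by simp),
    ← lintegral_const_mul' _ _ (by simp), ← lintegral_add_left']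
  · rw [fourierMat_sub]
    refine lintegral_mono_ae ?_
    filter_upwards [Lp.coeFn_sub (fourierMat f) (fourierMat g)] with ξ a
    rw [a, Pi.sub_apply]
    have h : ‖fourierMat f ξ - fourierMat g ξ‖ₑ ^ 2 ≤
        2 * ‖fourierMat f ξ‖ₑ ^ 2 + 2 * ‖fourierMat g ξ‖ₑ ^ 2 := by
      refine (pow_le_pow_left' enorm_sub_le 2).trans ?_
      have h2 := ENNReal.rpow_add_le_mul_rpow_add_rpow ‖fourierMat f ξ‖ₑ ‖fourierMat g ξ‖ₑ
        (one_le_two : (1 : ℝ) ≤ 2)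
      norm_num [mul_add] at h2
      exact h2
    refine (mul_le_mul_right h _).trans (le_of_eq ?_)
    ring
  · exact ((hm.measurable.pow_const 2).aemeasurable.mul
      ((aemeasurable_enorm_fourierMat f).pow_const 2)).const_mul _

/-! ### Sobolev norms -/

theorem sobolevWeight_le {s k : ℝ} {n : ℕ} (hs : 0 ≤ s) (hn : s ≤ n) (hk : 0 ≤ k) :
    1 + k ^ (2 * s) ≤ 2 * ((1 + k) ^ n) ^ 2 := by
  have h1 : (1 : ℝ) ≤ 1 + k := by linarith
  have h2 : k ^ (2 * s) ≤ ((1 + k) ^ n) ^ 2 := by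
    calc k ^ (2 * s) ≤ (1 + k) ^ (2 * s) := Real.rpow_le_rpow hk (by linarith) (by linarith)
      _ ≤ (1 + k) ^ ((n * 2 : ℕ) : ℝ) := by
          refine Real.rpow_le_rpow_of_exponent_le h1 ?_
          push_cast
          linarith
      _ = _ := by rw [Real.rpow_natCast, pow_mul]
  have h3 : 1 ≤ ((1 + k) ^ n) ^ 2 := one_le_pow₀ (one_le_pow₀ h1)
  linarith

theorem sobolevNormSq_le_lintegral {s : ℝ} {n : ℕ} (hs : 0 ≤ s) (hn : s ≤ n) (f : L2Mat) :
    sobolevNormSq s f ≤ 2 * fourierMoment n 1 f := by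
  rw [sobolevNormSq, fourierMoment, ← lintegral_const_mul' _ _ (by simp)]
  refine lintegral_mono fun ξ => ?_
  have h := ENNReal.ofReal_le_ofReal
    (sobolevWeight_le hs hn (by positivity : 0 ≤ 2 * Real.pi * ‖ξ‖))
  rw [ENNReal.ofReal_mul zero_le_two, ENNReal.ofReal_pow (by positivity),
    ENNReal.ofReal_ofNat] at h
  rw [one_mul, ← mul_assoc]
  exact mul_le_mul_left h _

/-- Interpolation between `L²` and a high Sobolev norm. -/
theorem fourierMoment_one_interpolation (n : ℕ) (f : L2Mat) :
    fourierMoment n 1 f ≤ ENNReal.ofReal ‖f‖ * fourierMoment (n * 2) 1 f ^ (1 / 2 : ℝ) := by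
  have hm : Continuous fun ξ : E3 =>
      ENNReal.ofReal ((1 + 1 * (2 * Real.pi * ‖ξ‖)) ^ (n * 2)) :=
    ENNReal.continuous_ofReal.comp (by fun_prop)
  have h := ENNReal.lintegral_mul_le_Lp_mul_Lq (volume : Measure E3) Real.HolderConjugate.two_two
    (aemeasurable_enorm_fourierMat f)
    (hm.measurable.aemeasurable.mul (aemeasurable_enorm_fourierMat f))
  simp only [Pi.mul_apply, ENNReal.rpow_two, mul_pow] at h
  rw [← norm_sq_L2, norm_fourierMat, ENNReal.ofReal_pow (norm_nonneg _), ← ENNReal.rpow_natCast,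
    ← ENNReal.rpow_mul] at h
  norm_num only [Nat.cast_ofNat, ENNReal.rpow_one] at h
  refine le_trans (le_of_eq (lintegral_congr fun ξ => ?_)) (h.trans (le_of_eq ?_))
  · have e := ENNReal.ofReal_pow
      (by positivity : 0 ≤ (1 + 1 * (2 * Real.pi * ‖ξ‖)) ^ n) 2
    rw [pow_mul, e]
    ring
  · rw [fourierMoment]

/-- Continuity in `L²` is interpolated with a bound on moments of twice the order, uniform on a
neighbourhood `[t/2, t₁]` of `t`. -/
theorem IsMildSolution.continuousHInfty {S0 : L2Mat} {T : ℝ≥0∞} {S : ℝ → L2Mat}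
    (h : IsMildSolution S0 T S) : ContinuousHInfty T S := by
  intro s hs t h0 ht
  obtain ⟨n, hn⟩ := exists_nat_ge s
  obtain ⟨t₁, ht₁, htT⟩ : ∃ t₁, t < t₁ ∧ ENNReal.ofReal t₁ < T := by
    have ho : {r : ℝ | ENNReal.ofReal r < T} ∈ 𝓝 t :=
      (isOpen_lt ENNReal.continuous_ofReal continuous_const).mem_nhds ht
    obtain ⟨ε, hε, hb⟩ := Metric.mem_nhds_iff.1 ho
    refine ⟨t + ε / 2, by linarith, hb ?_⟩
    rw [Metric.mem_ball, Real.dist_eq, add_sub_cancel_left, abs_of_pos (half_pos hε)]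
    exact half_lt_self hε
  have hI : Set.Icc (t / 2) t₁ ∈ 𝓝 t := Icc_mem_nhds (half_lt_self h0) ht₁
  obtain ⟨B, hB, hBt⟩ := h.exists_fourierMoment_bound (half_pos h0) ((half_lt_self h0).trans
    ht₁).le htT n
  obtain ⟨B', hB', hBt'⟩ := h.exists_fourierMoment_bound (half_pos h0) ((half_lt_self h0).trans
    ht₁).le htT (n * 2)
  refine ⟨(sobolevNormSq_le_lintegral hs hn _).trans_lt (ENNReal.mul_lt_top (by simp)
    ((hBt t (mem_of_mem_nhds hI)).trans_lt hB.lt_top)), ?_⟩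
  have hc : ContinuousAt S t :=
    (h.continuousOn_Icc htT).continuousAt (Icc_mem_nhds h0 ht₁)
  have hlim : Tendsto (fun τ => 2 * (ENNReal.ofReal ‖S τ - S t‖ *
      (2 * B' + 2 * B') ^ (1 / 2 : ℝ))) (𝓝 t) (𝓝 0) := by
    have h1 : Tendsto (fun τ => ENNReal.ofReal ‖S τ - S t‖) (𝓝 t) (𝓝 0) := by
      have h2 : ContinuousAt (fun τ => ‖S τ - S t‖) t := (hc.sub continuousAt_const).norm
      have h3 := (ENNReal.continuous_ofReal.tendsto _).comp h2
      simpa [Function.comp_def] using h3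
    have hfin : (2 * B' + 2 * B') ^ (1 / 2 : ℝ) ≠ ⊤ :=
      ENNReal.rpow_ne_top_of_nonneg (by norm_num) (ENNReal.add_ne_top.2
        ⟨ENNReal.mul_ne_top (by simp) hB', ENNReal.mul_ne_top (by simp) hB'⟩)
    have h4 := ENNReal.Tendsto.const_mul (a := 2)
      (ENNReal.Tendsto.mul_const (b := (2 * B' + 2 * B') ^ (1 / 2 : ℝ)) h1 (Or.inr hfin))
      (Or.inr (by simp))
    simpa using h4
  refine tendsto_of_tendsto_of_tendsto_of_le_of_le' tendsto_const_nhds hlim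
    (Eventually.of_forall fun _ => zero_le) ?_
  filter_upwards [hI] with τ hτ
  refine (sobolevNormSq_le_lintegral hs hn _).trans ?_
  gcongr
  refine (fourierMoment_one_interpolation n _).trans ?_
  gcongr
  refine (fourierMoment_sub_le _ _ _ _).trans ?_
  gcongr
  · exact hBt' τ hτ
  · exact hBt' t (mem_of_mem_nhds hI)

/-! ### Smooth representatives -/

/-- Cauchy–Schwarz against `(1 + |ξ|)^{-2}`, which is square integrable on `ℝ³` because `4 > 3`;
this costs the two extra powers. -/
theorem integrable_pow_mul_fourierMat {f : L2Mat} {n : ℕ}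
    (hf : fourierMoment (n + 2) 1 f < ⊤) :
    Integrable fun ξ => ‖ξ‖ ^ n * ‖fourierMat f ξ‖ := by
  have h2 : MemLp (fun ξ => (1 + 1 * (2 * Real.pi * ‖ξ‖)) ^ (n + 2) * ‖fourierMat f ξ‖) 2
      (volume : Measure E3) := by
    refine ⟨Continuous.aestronglyMeasurable (by fun_prop) |>.mul
      (Lp.aestronglyMeasurable (fourierMat f)).norm, ?_⟩
    refine lt_top_iff_ne_top.2 fun htop => hf.ne ?_
    have e := eLpNorm_two_sq (fun ξ => (1 + 1 * (2 * Real.pi * ‖ξ‖)) ^ (n + 2) * ‖fourierMat f ξ‖)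
    rw [htop, ENNReal.top_pow two_ne_zero] at e
    rw [fourierMoment, e]
    refine lintegral_congr fun ξ => ?_
    rw [enorm_mul, mul_pow, enorm_norm, Real.enorm_of_nonneg (by positivity)]
  have h1 : MemLp (fun ξ : E3 => (1 + ‖ξ‖) ^ (-2 : ℝ)) 2 volume := by
    have hc : Continuous fun ξ : E3 => (1 + ‖ξ‖) ^ (-2 : ℝ) := by
      refine Continuous.rpow_const (by fun_prop) fun ξ => Or.inl ?_
      positivity
    rw [memLp_two_iff_integrable_sq hc.aestronglyMeasurable]
    refine (integrable_one_add_norm (E := E3) (μ := volume) (r := 4) (by simp; norm_num)).congr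
      (Eventually.of_forall fun ξ => ?_)
    simp only
    rw [← Real.rpow_natCast, ← Real.rpow_mul (by positivity)]
    norm_num
  refine (h1.integrable_mul h2).mono' ?_ (Eventually.of_forall fun ξ => ?_)
  · exact Continuous.aestronglyMeasurable (by fun_prop) |>.mul
      (Lp.aestronglyMeasurable (fourierMat f)).norm
  · rw [Real.norm_of_nonneg (by positivity), Pi.mul_apply, ← mul_assoc]
    refine mul_le_mul_of_nonneg_right ?_ (norm_nonneg _)
    rw [Real.rpow_neg (by positivity), ← div_eq_inv_mul, le_div_iff₀ (by positivity)]
    have hpi : 1 ≤ 2 * Real.pi := by linarith [Real.pi_gt_three]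
    have h3 : ‖ξ‖ ≤ 2 * Real.pi * ‖ξ‖ := le_mul_of_one_le_left (norm_nonneg _) hpi
    calc ‖ξ‖ ^ n * (1 + ‖ξ‖) ^ (2 : ℝ) = ‖ξ‖ ^ n * (1 + ‖ξ‖) ^ 2 := by norm_num
      _ ≤ (1 + 1 * (2 * Real.pi * ‖ξ‖)) ^ n * (1 + 1 * (2 * Real.pi * ‖ξ‖)) ^ 2 := by
          gcongr <;> linarith
      _ = _ := (pow_add _ _ _).symm

/-- The inverse Fourier integral can be differentiated under the integral sign to every order, and
its real part represents `f`. -/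
theorem exists_contDiff_of_fourierMoment {f : L2Mat} (hf : ∀ n, fourierMoment n 1 f < ⊤) :
    ∃ σ : E3 → Mat3, ContDiff ℝ ∞ σ ∧ f =ᵐ[volume] σ := by
  have hi : ∀ n : ℕ, Integrable fun ξ => ‖ξ‖ ^ n * ‖fourierMat f ξ‖ :=
    fun n => integrable_pow_mul_fourierMat (hf (n + 2))
  have h1 : Integrable (fourierMat f : E3 → CMat3) := by
    refine (integrable_norm_iff (Lp.aestronglyMeasurable _)).1 ?_
    simpa using hi 0
  refine ⟨fun x => reMat (𝓕 (fourierMat f : E3 → CMat3) (-x)), ?_, ?_⟩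
  · exact reMat.contDiff.comp ((Real.contDiff_fourier (N := ⊤) fun n _ => hi n).comp contDiff_neg)
  · have e : (reFourierInv (fourierMat f) : L2Mat) =ᵐ[volume]
        fun x => reMat ((𝓕⁻ (fourierMat f) : L2CMat) x) :=
      reMat.coeFn_compLpL (𝓕⁻ (fourierMat f) : L2CMat)
    have e2 := fourierInv_toLp_ae_eq h1 (Lp.memLp (fourierMat f))
    rw [Lp.toLp_coeFn] at e2
    rw [reFourierInv_fourierMat] at e
    filter_upwards [e, e2] with x a b
    rw [a, b, Real.fourierInv_eq_fourier_neg]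

theorem mainTheorem5 (S0 : L2Mat) (hS0 : S0 ∈ L2st) :
    ∃ (Tmax : ℝ≥0∞) (S : ℝ → L2Mat),
      existenceConst / ‖S0‖ₑ ^ 4 ≤ Tmax ∧
      IsMildSolution S0 Tmax S ∧
      (∀ (T : ℝ≥0∞) (R : ℝ → L2Mat), IsMildSolution S0 T R →
        T ≤ Tmax ∧ ∀ t : ℝ, 0 ≤ t → ENNReal.ofReal t < T → R t = S t) ∧
      ContinuousHInfty Tmax S ∧
      ∀ t : ℝ, 0 < t → ENNReal.ofReal t < Tmax →
        ∃ σ : E3 → Mat3, ContDiff ℝ ∞ σ ∧ S t =ᵐ[volume] σ := by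
  obtain ⟨Tmax, S, hT, hS, hmax⟩ := exists_maximal_isMildSolution hS0
  refine ⟨Tmax, S, hT, hS, hmax, hS.continuousHInfty, fun t h0 ht => ?_⟩
  refine exists_contDiff_of_fourierMoment fun n => ?_
  obtain ⟨B, hB, hBt⟩ := hS.exists_fourierMoment_bound h0 le_rfl ht n
  exact (hBt t ⟨le_rfl, le_rfl⟩).trans_lt hB.lt_top
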